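/- Let $M$ be a smooth manifold (Hausdorff, second countable, finite-dimensional, without boundary) and let $H\subseteq TM$ be a contact structure, i.e. a smooth hyperplane distribution whose curvature $\kappa_H:\wedge^2H\to TM/H$, $(X,Y)\mapsto [X,Y]\bmod H$, is non-degenerate. Let $L=TM/H$ be the normal line bundle and $\theta_H:TM\to L$ the projection. A contact vector field is an $X\in\mathfrak X(M)$ with $[X,\Gamma(H)]\subseteq\Gamma(H)$. A derivation of $L$ is an $\mathbb R$-linear operator $D:\Gamma(L)\to\Gamma(L)$ with $D(f\lambda)=\sigma(D)(f)\lambda+fD(\lambda)$ for a vector field $\sigma(D)$, its symbol; derivations are the sections of the gauge algebroid $\mathsf DL$, whose fibre $\mathsf D_xL$ consists of the $\mathbb R$-linear maps $\delta:\Gamma(L)\to L_x$ with $\delta(f\lambda)=v(f)\lambda(x)+f(x)\delta(\lambda)$ for some $v\in T_xM$. Let $\mathsf J^1L$ be the first jet bundle of $L$. (1) For each $\lambda\in\Gamma(L)$ there is a unique contact vector field $X_\lambda$ with $\theta_H(X_\lambda)=\lambda$; put $\{\lambda,\mu\}=\theta_H([X_\lambda,X_\mu])$. (2) The pairing $\langle\delta,j^1_x\lambda\rangle=\delta(\lambda)$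 induces, at every $x\in M$, isomorphisms $\mathsf J^1_xL\cong\mathrm{Hom}(\mathsf D_xL,L_x)$ and $\mathsf D_xL\cong\mathrm{Hom}(\mathsf J^1_xL,L_x)$. (3) There is a unique smooth alternating $2$-form $\omega:\wedge^2\mathsf DL\to L$ with $\omega=d_{\mathsf D}\Theta$ for $\Theta=\theta_H\circ\sigma$, that is, $$\omega(D_1,D_2)=D_1(\theta_H(\sigma(D_2)))-D_2(\theta_H(\sigma(D_1)))-\theta_H(\sigma([D_1,D_2]))$$ for all derivations $D_1,D_2$ of $L$ (the symplectic Atiyah form of $(M,H)$), and a unique smooth alternating $2$-form $J:\wedge^2\mathsf J^1L\to L$ with $J(j^1\lambda,j^1\mu)=\{\lambda,\mu\}$ for all $\lambda,\mu\in\Gamma(L)$ (the Jacobi tensor of $(M,H)$). (4) $J$ is the inverse of $\omega$: at every point $x$, the map $\omega_\flat:\mathsf D_xL\to\mathrm{Hom}(\mathsf D_xL,L_x)\cong\mathsf J^1_xL$, $\delta\mapsto\omega(\delta,-)$, is an isomorphism, and its inverse is the map $\mathsf J^1_xL\to\mathrm{Hom}(\mathsf J^1_xL,L_x)\cong\mathsf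 D_xL$, $\psi\mapsto J(-,\psi)$; equivalently, $\omega_\flat$ is an isomorphism and $J(\omega_\flat\delta,\omega_\flat\delta')=\omega(\delta,\delta')$ for all $\delta,\delta'\in\mathsf D_xL$. -/

import Mathlib

noncomputable section

namespace ContactGeometry

open scoped Manifold ContDiff Topology
open VectorField

variable {E : Type*} [NormedAddCommGroup E] [NormedSpace ℝ E]
  {M : Type*} [TopologicalSpace M] [ChartedSpace E M]

/-- The algebra `C^∞(M)` of smooth real functions. -/
abbrev SmoothFunction (E : Type*) [NormedAddCommGroup E] [NormedSpace ℝ E]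
    (M : Type*) [TopologicalSpace M] [ChartedSpace E M] : Type _ :=
  ContMDiffMap 𝓘(ℝ, E) 𝓘(ℝ, ℝ) M ℝ ∞

/-- The space `𝔛(M)` of smooth vector fields. -/
abbrev SmoothField (E : Type*) [NormedAddCommGroup E] [NormedSpace ℝ E]
    (M : Type*) [TopologicalSpace M] [ChartedSpace E M] [IsManifold 𝓘(ℝ, E) ∞ M] : Type _ :=
  ContMDiffSection 𝓘(ℝ, E) E ∞ (TangentSpace 𝓘(ℝ, E) : M → Type _)

/-- A field of linear subspaces of the tangent spaces. -/
abbrev SubspaceField (E : Type*) [NormedAddCommGroup E] [NormedSpace ℝ E]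
    (M : Type*) [TopologicalSpace M] [ChartedSpace E M] : Type _ :=
  ∀ x : M, Submodule ℝ (TangentSpace 𝓘(ℝ, E) x)

/-- The fibre `L_x = T_x M / H_x` of the normal bundle. -/
abbrev NormalFibre (H : SubspaceField E M) (x : M) : Type _ :=
  TangentSpace 𝓘(ℝ, E) x ⧸ H x

/-- The differential of a smooth function at `x`, evaluated on a tangent vector at `x`. -/
def dAt (f : SmoothFunction E M) (x : M) (v : TangentSpace 𝓘(ℝ, E) x) : ℝ :=
  mvfderiv 𝓘(ℝ, E) f x v

theorem mdiff_function (f : SmoothFunction E M) (x : M) :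
    MDifferentiableAt 𝓘(ℝ, E) 𝓘(ℝ, ℝ) f x :=
  (f.contMDiff x).mdifferentiableAt (by simp)

section Calculus

variable [IsManifold 𝓘(ℝ, E) ∞ M]

/-- The product `f X` of a smooth function and a smooth vector field. -/
def smulField (f : SmoothFunction E M) (X : SmoothField E M) : SmoothField E M :=
  ⟨fun x => f x • X x, f.contMDiff.smul_section X.contMDiff⟩

/-- The derivative `X(f)` of a smooth function along a smooth vector field. -/
def fieldAct (X : SmoothField E M) (f : SmoothFunction E M) : SmoothFunction E M :=
  ⟨fun x => dAt f x (X x), by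
    have h := (f.contMDiff.contMDiff_tangentMap (m := ∞) (by simp)).comp X.contMDiff
    have h2 := (contMDiff_snd_tangentBundle_modelSpace ℝ 𝓘(ℝ, ℝ) (n := ∞)).comp h
    exact h2⟩

theorem minSmoothness_two_le : minSmoothness ℝ 2 ≤ (∞ : WithTop ℕ∞) := by
  simpa using (by exact_mod_cast le_top : ((2 : ℕ∞) : WithTop ℕ∞) ≤ ((⊤ : ℕ∞) : WithTop ℕ∞))

theorem minSmoothness_three_le : minSmoothness ℝ 3 ≤ (∞ : WithTop ℕ∞) := by
  simpa using (by exact_mod_cast le_top : ((3 : ℕ∞) : WithTop ℕ∞) ≤ ((⊤ : ℕ∞) : WithTop ℕ∞))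

theorem mdiff_field (X : SmoothField E M) (x : M) :
    MDifferentiableAt 𝓘(ℝ, E) (𝓘(ℝ, E).prod 𝓘(ℝ, E))
      (fun y => (⟨y, X y⟩ : TangentBundle 𝓘(ℝ, E) M)) x :=
  (X.contMDiff x).mdifferentiableAt (by simp)

variable [FiniteDimensional ℝ E]

/-- The Lie bracket of smooth vector fields. -/
def fieldBracket (X Y : SmoothField E M) : SmoothField E M :=
  ⟨mlieBracket 𝓘(ℝ, E) X Y, by
    have : CompleteSpace E := FiniteDimensional.complete ℝ E
    have : IsManifold 𝓘(ℝ, E) (((⊤ : ℕ∞) : WithTop ℕ∞) + 1) M := by simpa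
    have : IsManifold 𝓘(ℝ, E) (minSmoothness ℝ 2) M :=
      IsManifold.of_le minSmoothness_two_le
    have : IsManifold 𝓘(ℝ, E) (minSmoothness ℝ 3) M :=
      IsManifold.of_le minSmoothness_three_le
    exact ContDiff.mlieBracket_vectorField (m := ⊤) (n := ⊤) X.contMDiff Y.contMDiff (by simp)⟩

/-- The Lie bracket acts on functions as the commutator of the two derivatives. -/
theorem dAt_fieldBracket (X Y : SmoothField E M) (f : SmoothFunction E M) (x : M) :
    dAt f x (fieldBracket X Y x) =
      dAt (fieldAct Y f) x (X x) - dAt (fieldAct X f) x (Y x) := by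
  have : CompleteSpace E := FiniteDimensional.complete ℝ E
  have : IsManifold 𝓘(ℝ, E) (minSmoothness ℝ 3) M :=
    IsManifold.of_le minSmoothness_three_le
  have : IsManifold 𝓘(ℝ, E) (minSmoothness ℝ 2) M :=
    IsManifold.of_le minSmoothness_two_le
  have h2 : ∀ (Z : SmoothField E M), ContMDiffAt 𝓘(ℝ, E) (𝓘(ℝ, E).prod 𝓘(ℝ, E))
      (minSmoothness ℝ 2) (fun y => (⟨y, Z y⟩ : TangentBundle 𝓘(ℝ, E) M)) x := fun Z =>
    (Z.contMDiff x).of_le minSmoothness_two_le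
  have key : ∀ w : TangentSpace 𝓘(ℝ, E) x,
      (dAt (fieldAct Y f) x (X x) - dAt (fieldAct X f) x (Y x)
        - dAt f x (fieldBracket X Y x)) • w = 0 := by
    intro w
    let W : ∀ y : M, TangentSpace 𝓘(ℝ, E) y := FiberBundle.extend E w
    have hW : ContMDiffAt 𝓘(ℝ, E) (𝓘(ℝ, E).prod 𝓘(ℝ, E)) ∞
        (fun y => (⟨y, W y⟩ : TangentBundle 𝓘(ℝ, E) M)) x :=
      FiberBundle.contMDiffAt_extend 𝓘(ℝ, E) E w
    have hWx : W x = w := by simp [W]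
    have hWd : ∀ᶠ y in 𝓝 x, MDifferentiableAt 𝓘(ℝ, E) (𝓘(ℝ, E).prod 𝓘(ℝ, E))
        (fun y => (⟨y, W y⟩ : TangentBundle 𝓘(ℝ, E) M)) y := by
      obtain ⟨u, hu, h⟩ := FiberBundle.exists_contMDiffOn_extend (k := 1) 𝓘(ℝ, E) E w
      filter_upwards [eventually_mem_nhds_iff.2 hu] with y hy
      exact (h.contMDiffAt hy).mdifferentiableAt one_ne_zero
    have hWx' := hWd.self_of_nhds
    have hB : ∀ Z : SmoothField E M, MDifferentiableAt 𝓘(ℝ, E) (𝓘(ℝ, E).prod 𝓘(ℝ, E))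
        (fun y => (⟨y, mlieBracket 𝓘(ℝ, E) Z W y⟩ : TangentBundle 𝓘(ℝ, E) M)) x := by
      intro Z
      have : IsManifold 𝓘(ℝ, E) (((2 : ℕ∞) : WithTop ℕ∞) + 1) M :=
        IsManifold.of_le (n := ∞) (by exact_mod_cast le_top)
      exact (ContMDiffAt.mlieBracket_vectorField (m := 1) (n := 2)
        ((Z.contMDiff x).of_le (by exact_mod_cast le_top))
        (hW.of_le (by exact_mod_cast le_top))
        (by simp [one_add_one_eq_two])).mdifferentiableAt (by simp)
    have step : ∀ Y : SmoothField E M, mlieBracket 𝓘(ℝ, E) Y ((f : M → ℝ) • W) =ᶠ[𝓝 x]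
        ((fieldAct Y f : M → ℝ) • W + (f : M → ℝ) • mlieBracket 𝓘(ℝ, E) Y W) := by
      intro Y
      filter_upwards [hWd] with y hy
      exact mlieBracket_smul_right (mdiff_function f y) hy
    have exp : ∀ X Y : SmoothField E M,
        mlieBracket 𝓘(ℝ, E) X (mlieBracket 𝓘(ℝ, E) Y ((f : M → ℝ) • W)) x =
          (dAt (fieldAct Y f) x (X x) • W x
            + (fieldAct Y f x) • mlieBracket 𝓘(ℝ, E) X W x)
          + (dAt f x (X x) • mlieBracket 𝓘(ℝ, E) Y W x
            + f x • mlieBracket 𝓘(ℝ, E) X (mlieBracket 𝓘(ℝ, E) Y W) x) := by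
      intro X Y
      rw [Filter.EventuallyEq.mlieBracket_vectorField_eq
        (Filter.EventuallyEq.refl (𝓝 x) (X : ∀ y : M, TangentSpace 𝓘(ℝ, E) y)) (step Y),
        mlieBracket_add_right, mlieBracket_smul_right (mdiff_function _ x) hWx',
        mlieBracket_smul_right (mdiff_function _ x) (hB Y)]
      · rfl
      · exact (mdiff_function _ x).smul_section hWx'
      · exact (mdiff_function _ x).smul_section (hB Y)
    have hfW : ContMDiffAt 𝓘(ℝ, E) (𝓘(ℝ, E).prod 𝓘(ℝ, E)) ∞
        (fun y => (⟨y, ((f : M → ℝ) • W) y⟩ : TangentBundle 𝓘(ℝ, E) M)) x :=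
      (f.contMDiff x).smul_section hW
    have J1 := leibniz_identity_mlieBracket_apply (I := 𝓘(ℝ, E)) (h2 X) (h2 Y)
      (hfW.of_le minSmoothness_two_le)
    have J2 := leibniz_identity_mlieBracket_apply (I := 𝓘(ℝ, E)) (h2 X) (h2 Y)
      (hW.of_le minSmoothness_two_le)
    rw [exp, exp, mlieBracket_smul_right (mdiff_function f x) hWx', J2] at J1
    have e1 : fieldAct Y f x = dAt f x (Y x) := rfl
    have e2 : fieldAct X f x = dAt f x (X x) := rfl
    have e3 : mvfderiv 𝓘(ℝ, E) f x (mlieBracket 𝓘(ℝ, E) X Y x)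
      = dAt f x (fieldBracket X Y x) := rfl
    rw [e1, e2, e3, hWx] at J1
    rw [sub_smul, sub_smul]
    rw [← sub_eq_zero] at J1
    rw [← J1]
    module
  by_cases hE : Subsingleton (TangentSpace 𝓘(ℝ, E) x)
  · rw [Subsingleton.elim (fieldBracket X Y x) 0, Subsingleton.elim (X x) 0,
      Subsingleton.elim (Y x) 0]
    simp [dAt]
  · rw [not_subsingleton_iff_nontrivial] at hE
    obtain ⟨w, hw⟩ := exists_ne (0 : TangentSpace 𝓘(ℝ, E) x)
    have := (smul_eq_zero.1 (key w)).resolve_right hw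
    linarith

end Calculus

section Contact

variable [IsManifold 𝓘(ℝ, E) ∞ M]

/-- The space `Γ(L)` of smooth sections of the normal bundle `L = TM/H`: the families of elements
of the fibres `T_x M / H_x` which are, near every point, classes of a smooth vector field. (A vector
field defined near a point can be cut off, so local and global vector fields give the same
families.) -/
def normalSections (H : SubspaceField E M) : Submodule ℝ (∀ x : M, NormalFibre H x) where
  carrier := {s | ∀ x₀ : M, ∃ X : SmoothField E M, ∀ᶠ x in 𝓝 x₀, s x = (H x).mkQ (X x)}
  zero_mem' := fun _ => ⟨0, Filter.Eventually.of_forall fun x => by simp⟩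
  add_mem' := by
    intro s t hs ht x₀
    obtain ⟨X, hX⟩ := hs x₀
    obtain ⟨Y, hY⟩ := ht x₀
    refine ⟨X + Y, ?_⟩
    filter_upwards [hX, hY] with x h1 h2
    simp [h1, h2]
  smul_mem' := by
    intro c s hs x₀
    obtain ⟨X, hX⟩ := hs x₀
    refine ⟨c • X, ?_⟩
    filter_upwards [hX] with x h1
    simp [h1]

/-- The projection `θ_H : 𝔛(M) → Γ(L)`, `X ↦ X mod H`. -/
def theta (H : SubspaceField E M) : SmoothField E M →ₗ[ℝ] normalSections H where
  toFun X := ⟨fun x => (H x).mkQ (X x), fun _ => ⟨X, Filter.Eventually.of_forall fun _ => rfl⟩⟩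
  map_add' X Y := by ext x; simp
  map_smul' c X := by ext x; simp

/-- The product `f λ` of a smooth function and a section of `L`. -/
def smulSection {H : SubspaceField E M} (f : SmoothFunction E M) (s : normalSections H) :
    normalSections H :=
  ⟨fun x => f x • s.1 x, by
    intro x₀
    obtain ⟨X, hX⟩ := s.2 x₀
    refine ⟨smulField f X, ?_⟩
    filter_upwards [hX] with x h1
    rw [h1, ← map_smul]
    rfl⟩

/-- The space `Γ(H)` of smooth vector fields tangent to `H`. -/
def tangentFields (H : SubspaceField E M) : Submodule ℝ (SmoothField E M) where
  carrier := {X | ∀ x, X x ∈ H x}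
  zero_mem' := fun x => by simp
  add_mem' := fun hX hY x => by simpa using (H x).add_mem (hX x) (hY x)
  smul_mem' := fun c _ hX x => by simpa using (H x).smul_mem c (hX x)

section Derivations

variable (H : SubspaceField E M)

/-- The space `Γ(DL)` of derivations of `L`: the `ℝ`-linear operators `D` on `Γ(L)` with
`D(f λ) = X(f) λ + f D(λ)` for a smooth vector field `X`. When `L` is a line bundle, `X` is
determined by `D`, so a derivation is recorded here as the pair `(D, X)`. -/
def derivations :
    Submodule ℝ ((normalSections H →ₗ[ℝ] normalSections H) × SmoothField E M) where
  carrier := {D | ∀ (f : SmoothFunction E M) (s : normalSections H),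
    D.1 (smulSection f s) = smulSection (fieldAct D.2 f) s + smulSection f (D.1 s)}
  zero_mem' := by
    intro f s
    ext x
    simp [smulSection, fieldAct, dAt]
  add_mem' := by
    intro D D' h h' f s
    ext x
    simp only [Prod.fst_add, LinearMap.add_apply, h f s, h' f s]
    simp only [smulSection, fieldAct, dAt, Prod.snd_add, ContMDiffSection.coe_add, Pi.add_apply,
      map_add, Submodule.coe_add, ContMDiffMap.coeFn_mk]
    module
  smul_mem' := by
    intro c D h f s
    ext x
    simp only [Prod.smul_fst, LinearMap.smul_apply, h f s]
    simp only [smulSection, fieldAct, dAt, Prod.smul_snd, ContMDiffSection.coe_smul, Pi.smul_apply,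
      map_smul, Submodule.coe_smul, Submodule.coe_add, Pi.add_apply, ContMDiffMap.coeFn_mk,
      smul_eq_mul]
    module

/-- The fibre `D_x L` of the gauge algebroid: the `ℝ`-linear maps `δ : Γ(L) → L_x` with
`δ(f λ) = v(f) λ(x) + f(x) δ(λ)` for a tangent vector `v ∈ T_x M`, recorded as the pairs
`(δ, v)`. -/
def derivationFibre (x : M) :
    Submodule ℝ ((normalSections H →ₗ[ℝ] NormalFibre H x) × TangentSpace 𝓘(ℝ, E) x) where
  carrier := {δ | ∀ (f : SmoothFunction E M) (s : normalSections H),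
    δ.1 (smulSection f s) = dAt f x δ.2 • s.1 x + f x • δ.1 s}
  zero_mem' := by
    intro f s
    simp [dAt]
  add_mem' := by
    intro D D' h h' f s
    simp only [Prod.fst_add, LinearMap.add_apply, h f s, h' f s, dAt, Prod.snd_add, map_add]
    module
  smul_mem' := by
    intro c D h f s
    simp only [Prod.smul_fst, LinearMap.smul_apply, h f s, dAt, Prod.smul_snd, map_smul,
      smul_eq_mul]
    module

variable {H}

/-- The action `D(λ)` of a derivation on a section. -/
def derivationApply (D : derivations H) (s : normalSections H) : normalSections H := D.1.1 s

/-- The symbol `σ(D)` of a derivation. -/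
def symbol (D : derivations H) : SmoothField E M := D.1.2

/-- The value `D_x ∈ D_x L` of a derivation at the point `x`. -/
def derivationAt (D : derivations H) (x : M) : derivationFibre H x :=
  ⟨((LinearMap.proj x ∘ₗ (normalSections H).subtype) ∘ₗ D.1.1, D.1.2 x), by
    intro f s
    simp only [LinearMap.comp_apply, D.2 f s]
    rfl⟩

/-- The commutator `[D₁, D₂]` of two derivations, with symbol `[σ(D₁), σ(D₂)]`. -/
def derivationBracket [FiniteDimensional ℝ E] (D₁ D₂ : derivations H) : derivations H :=
  ⟨(D₁.1.1 ∘ₗ D₂.1.1 - D₂.1.1 ∘ₗ D₁.1.1, fieldBracket D₁.1.2 D₂.1.2), by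
    intro f s
    simp only [LinearMap.sub_apply, LinearMap.comp_apply, D₁.2 f s, D₂.2 f s, map_add, D₁.2 _ _,
      D₂.2 _ _]
    ext x
    have h := dAt_fieldBracket D₁.1.2 D₂.1.2 f x
    have e1 : ∀ (g : SmoothFunction E M) (X : SmoothField E M),
      (fieldAct X g) x = dAt g x (X x) := fun _ _ => rfl
    have e2 : ∀ (g : SmoothFunction E M) (t : normalSections H),
      (smulSection g t).1 x = g x • t.1 x := fun _ _ => rfl
    simp only [Submodule.coe_add, Submodule.coe_sub, Pi.add_apply, Pi.sub_apply, e2, e1, h]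
    module⟩

/-- The differential `d_D α (D₁, D₂) = D₁(α(D₂)) - D₂(α(D₁)) - α([D₁, D₂])` of an Atiyah
`1`-form `α`. -/
def atiyahDifferential [FiniteDimensional ℝ E] (α : derivations H →ₗ[ℝ] normalSections H)
    (D₁ D₂ : derivations H) : normalSections H :=
  derivationApply D₁ (α D₂) - derivationApply D₂ (α D₁) - α (derivationBracket D₁ D₂)

variable (H)

/-- The Atiyah `1`-form `Θ = θ_H ∘ σ`. -/
def atiyahTheta : derivations H →ₗ[ℝ] normalSections H :=
  theta H ∘ₗ LinearMap.snd ℝ _ _ ∘ₗ (derivations H).subtype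

/-- An Atiyah `2`-form `∧²DL → L`: a smooth family of alternating bilinear maps
`D_x L × D_x L → L_x`. -/
structure AtiyahTwoForm where
  /-- the bilinear map at a point -/
  toFun : ∀ x : M, derivationFibre H x →ₗ[ℝ] derivationFibre H x →ₗ[ℝ] NormalFibre H x
  alternating : ∀ x δ, toFun x δ δ = 0
  smooth : ∀ D₁ D₂ : derivations H,
    (fun x => toFun x (derivationAt D₁ x) (derivationAt D₂ x)) ∈ normalSections H

end Derivations

section Jets

variable (H : SubspaceField E M)

/-- The sections of `L` whose first jet at `x` vanishes: the span of the products `f μ`, where `f`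
is a function with `f(x) = 0` and `df_x = 0`, and `μ` is a section of `L`. -/
def vanishingJets (x : M) : Submodule ℝ (normalSections H) :=
  Submodule.span ℝ {s | ∃ (f : SmoothFunction E M) (m : normalSections H),
    f x = 0 ∧ (∀ v, dAt f x v = 0) ∧ s = smulSection f m}

/-- The fibre `J¹_x L` of the first jet bundle of `L`. -/
abbrev JetFibre (x : M) : Type _ := normalSections H ⧸ vanishingJets H x

variable {H}

/-- The first jet `j¹_x λ` of a section at `x`. -/
def jet (x : M) (s : normalSections H) : JetFibre H x := (vanishingJets H x).mkQ s

variable (H)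

/-- The pairing `J¹_x L → Hom(D_x L, L_x)`, `j¹_x λ ↦ (δ ↦ δ(λ))`. -/
def jetPairing (x : M) : JetFibre H x →ₗ[ℝ] derivationFibre H x →ₗ[ℝ] NormalFibre H x :=
  (vanishingJets H x).liftQ
    (LinearMap.mk₂ ℝ (fun (s : normalSections H) (δ : derivationFibre H x) => δ.1.1 s)
      (fun s t δ => map_add _ _ _) (fun c s δ => map_smul _ _ _)
      (fun s δ δ' => rfl) (fun c s δ => rfl))
    (by
      refine Submodule.span_le.2 ?_
      rintro s ⟨f, m, hf, hdf, rfl⟩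
      refine LinearMap.ext fun δ => ?_
      have h := δ.2 f m
      rw [hf, hdf, zero_smul, zero_smul, add_zero] at h
      exact h)

/-- A `2`-form `∧²J¹L → L` on the first jet bundle: a smooth family of alternating bilinear maps
`J¹_x L × J¹_x L → L_x`. Smoothness is tested on the sections `j¹λ`, which generate the smooth
sections of `J¹L` over `C^∞(M)`. -/
structure JetTwoForm where
  /-- the bilinear map at a point -/
  toFun : ∀ x : M, JetFibre H x →ₗ[ℝ] JetFibre H x →ₗ[ℝ] NormalFibre H x
  alternating : ∀ x ψ, toFun x ψ ψ = 0
  smooth : ∀ s t : normalSections H, (fun x => toFun x (jet x s) (jet x t)) ∈ normalSections H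

end Jets

variable [FiniteDimensional ℝ E] (H : SubspaceField E M)

/-- `H` is a contact structure: a smooth hyperplane distribution whose curvature
`κ_H : ∧²H → TM/H`, `(X, Y) ↦ [X, Y] mod H`, is non-degenerate at every point. Given constant
corank, `H` is a smooth subbundle of `TM` iff each of its vectors is a value of a smooth vector
field tangent to `H`. -/
structure IsContactStructure : Prop where
  corank_one : ∀ x : M, Module.finrank ℝ (NormalFibre H x) = 1
  smooth : ∀ (x : M), ∀ v ∈ H x, ∃ X ∈ tangentFields H, X x = v
  nondegenerate : ∀ (x : M), ∀ X ∈ tangentFields H,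
    (∀ Y ∈ tangentFields H, (H x).mkQ (fieldBracket X Y x) = 0) → X x = 0

/-- Contact vector fields: the infinitesimal symmetries of `H`. -/
def IsContactField (X : SmoothField E M) : Prop :=
  ∀ Y ∈ tangentFields H, fieldBracket X Y ∈ tangentFields H

open Classical in
/-- The Hamiltonian vector field `X_λ`: the contact vector field with `θ_H(X_λ) = λ` (the value `0`
is a placeholder, for the case that there is none). -/
def hamiltonianField (s : normalSections H) : SmoothField E M :=
  if h : ∃ X : SmoothField E M, IsContactField H X ∧ theta H X = s then h.choose else 0

/-- The Jacobi bracket `{λ, μ} = θ_H([X_λ, X_μ])`. -/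
def jacobiBracket (s t : normalSections H) : normalSections H :=
  theta H (fieldBracket (hamiltonianField H s) (hamiltonianField H t))

/-- `Ω` is the Atiyah form `d_D Θ` associated to `H`. -/
def IsAssociatedAtiyahForm (Ω : AtiyahTwoForm H) : Prop :=
  ∀ (D₁ D₂ : derivations H) (x : M),
    Ω.toFun x (derivationAt D₁ x) (derivationAt D₂ x) =
      (atiyahDifferential (atiyahTheta H) D₁ D₂).1 x

/-- `J` is the Jacobi tensor of `H`, that is, the Jacobi bracket seen as a `2`-form on `J¹L`. -/
def IsJacobiTensor (J : JetTwoForm H) : Prop :=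
  ∀ (s t : normalSections H) (x : M),
    J.toFun x (jet x s) (jet x t) = (jacobiBracket H s t).1 x

/-- `J` is the inverse of `Ω`: at every point, `δ ↦ Ω(δ, -)` is an isomorphism
`Ω_♭ : D_x L → Hom(D_x L, L_x) = J¹_x L`, and its inverse is
`J¹_x L → Hom(J¹_x L, L_x) = D_x L`, `ψ ↦ J(-, ψ)`. Equivalently,
`J(Ω_♭ δ, Ω_♭ δ') = Ω(δ, δ')`. -/
def IsInverse (Ω : AtiyahTwoForm H) (J : JetTwoForm H) : Prop :=
  ∀ x : M, ∃ flat : derivationFibre H x ≃ₗ[ℝ] JetFibre H x,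
    (∀ δ δ' : derivationFibre H x, Ω.toFun x δ δ' = jetPairing H x (flat δ) δ') ∧
    (∀ ψ ψ' : JetFibre H x, J.toFun x ψ' ψ = jetPairing H x ψ' (flat.symm ψ))

end Contact

end ContactGeometry

end

open scoped Manifold ContDiff

noncomputable section

namespace ContactGeometry

open scoped Manifold ContDiff Topology
open VectorField Bundle

/-! ### Cut-offs, extension of local data, and test functions. -/

section Localization

variable {E : Type*} [NormedAddCommGroup E] [NormedSpace ℝ E]
  {M : Type*} [TopologicalSpace M] [ChartedSpace E M]

/-! Existence and uniqueness of `X_λ` are linear algebra over a local frame of `H`. Modulo `H`, the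
bracket of any field with a field of `Γ(H)` is `C^∞`-linear in the latter. So, starting from any
lift `Y` of `λ`, the `H`-component to be subtracted solves a linear system whose matrix is the
curvature in the frame; this matrix is invertible. Non-degeneracy also gives uniqueness point by
point, so the local solutions glue (`existsUnique_contactField`).

The pairing of `J¹_x L` with `D_x L` is non-degenerate on both sides: near `x` a section is `f ρ`
for a generator `ρ`, and a derivation at `x` sends it to `v(f) ρ(x) + f(x) w` with `v` and `w`
arbitrary. As `L_x` is a line and `D_x L` is finite-dimensional, both induced maps are bijective.

Since `X_s` is contact, `θ[X_s, Y]` depends only on the class of `Y`, so `{s, θ Y} = θ[X_s, Y]` and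
`Δ_s = {s, -}` is a derivation with symbol `X_s`. In `d_D Θ (Δ_s, D)` two of the three terms cancel,
which leaves `-D(s)` (`atiyahDifferential_hamiltonianDerivation`). Hence `ω_♭` must be minus the
inverse of `sharp : j¹s ↦ Δ_s`. By skew-symmetry of the Jacobi bracket, `J(-, ψ)` is `sharp (-ψ)`,
and this is the claim.

What remains is that `sharp` is bijective (`sharp_injective` and equal dimensions), so that the
values of the `Δ_s` fill `D_x L`, and that `d_D Θ` at `x` depends only on the values of its
arguments at `x` (`atiyahDifferential_congr_left`). -/

instance finiteDimensional_tangentSpace [FiniteDimensional ℝ E] (x : M) :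
    FiniteDimensional ℝ (TangentSpace 𝓘(ℝ, E) x) :=
  inferInstanceAs (FiniteDimensional ℝ E)

theorem finrank_tangentSpace (x : M) :
    Module.finrank ℝ (TangentSpace 𝓘(ℝ, E) x) = Module.finrank ℝ E := rfl

/-- Evaluation of smooth functions at a point. -/
abbrev evalAt (y : M) : SmoothFunction E M →+* ℝ :=
  ContMDiffMap.evalRingHom y

theorem evalAt_apply (y : M) (f : SmoothFunction E M) : evalAt y f = f y := rfl

theorem dAt_congr {f g : SmoothFunction E M} {x : M} (h : ∀ᶠ y in 𝓝 x, f y = g y)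
    (v : TangentSpace 𝓘(ℝ, E) x) : dAt f x v = dAt g x v := by
  have h' : (f : M → ℝ) =ᶠ[𝓝 x] g := h
  simp only [dAt, mvfderiv, ContinuousLinearMap.comp_apply, h'.mfderiv_eq]
  rfl

theorem dAt_eq_zero_of_eventually_const {f : SmoothFunction E M} {x : M} {c : ℝ}
    (h : ∀ᶠ y in 𝓝 x, f y = c) (v : TangentSpace 𝓘(ℝ, E) x) : dAt f x v = 0 := by
  have h1 := dAt_congr (g := ContMDiffMap.const c) h v
  rw [h1]
  change mvfderiv 𝓘(ℝ, E) (fun _ : M => c) x v = 0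
  rw [mvfderiv_const]
  rfl

theorem dAt_add (f g : SmoothFunction E M) (x : M) (v : TangentSpace 𝓘(ℝ, E) x) :
    dAt (f + g) x v = dAt f x v + dAt g x v := by
  change mvfderiv 𝓘(ℝ, E) ((f : M → ℝ) + (g : M → ℝ)) x v = _
  rw [mvfderiv_add (mdiff_function f x) (mdiff_function g x)]
  rfl

theorem dAt_mul (f g : SmoothFunction E M) (x : M) (v : TangentSpace 𝓘(ℝ, E) x) :
    dAt (f * g) x v = f x * dAt g x v + g x * dAt f x v := by
  change mvfderiv 𝓘(ℝ, E) ((f : M → ℝ) * (g : M → ℝ)) x v = _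
  rw [mvfderiv_mul (mdiff_function f x) (mdiff_function g x)]
  rfl

variable [IsManifold 𝓘(ℝ, E) ∞ M]

@[simp] theorem smulField_apply (f : SmoothFunction E M) (X : SmoothField E M) (y : M) :
    smulField f X y = f y • X y := rfl

theorem sum_field_apply {ι : Type*} (s : Finset ι) (X : ι → SmoothField E M) (y : M) :
    (∑ i ∈ s, X i) y = ∑ i ∈ s, X i y := by
  classical
  induction s using Finset.induction_on with
  | empty => simp
  | insert a s ha ih => simp [Finset.sum_insert ha, ih]

variable [FiniteDimensional ℝ E] [T2Space M]

theorem exists_bump {x : M} {U : Set M} (hU : U ∈ 𝓝 x) :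
    ∃ χ : SmoothFunction E M, (∀ᶠ y in 𝓝 x, χ y = 1) ∧ tsupport χ ⊆ U := by
  obtain ⟨φ, -, hφ⟩ := (SmoothBumpFunction.nhds_basis_tsupport (I := 𝓘(ℝ, E)) x).mem_iff.1 hU
  exact ⟨⟨φ, φ.contMDiff⟩, φ.eventuallyEq_one, hφ⟩

/-- Multiply by a bump function supported in `V`. The neighbourhood `U` is chosen before `g`, so it
serves a whole family of functions at once. -/
theorem exists_nhds_extend_function {x : M} {V : Set M} (hV : IsOpen V) (hx : x ∈ V) :
    ∃ U : Set M, IsOpen U ∧ x ∈ U ∧ U ⊆ V ∧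
      ∀ g : M → ℝ, ContMDiffOn 𝓘(ℝ, E) 𝓘(ℝ, ℝ) ∞ g V →
        ∃ f : SmoothFunction E M, ∀ y ∈ U, f y = g y := by
  obtain ⟨χ, h1, hs⟩ := exists_bump (E := E) (hV.mem_nhds hx)
  obtain ⟨U, hU, hUo, hxU⟩ := eventually_nhds_iff.1 h1
  refine ⟨U, hUo, hxU, fun y hy => hs (subset_closure ?_), fun g hg => ?_⟩
  · simp [hU y hy]
  · refine ⟨⟨fun y => χ y * g y, ?_⟩, fun y hy => by
      change χ y * g y = g y
      rw [hU y hy, one_mul]⟩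
    refine contMDiff_of_tsupport fun y hy => ?_
    have hyV : y ∈ V := hs (tsupport_mul_subset_left hy)
    exact (χ.contMDiff y).mul (hg.contMDiffAt (hV.mem_nhds hyV))

theorem exists_nhds_extend_field {x : M} {V : Set M} (hV : IsOpen V) (hx : x ∈ V) :
    ∃ U : Set M, IsOpen U ∧ x ∈ U ∧ U ⊆ V ∧
      ∀ W : ∀ y : M, TangentSpace 𝓘(ℝ, E) y,
        ContMDiffOn 𝓘(ℝ, E) (𝓘(ℝ, E).prod 𝓘(ℝ, E)) ∞
          (fun y => (⟨y, W y⟩ : TangentBundle 𝓘(ℝ, E) M)) V →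
        ∃ X : SmoothField E M, ∀ y ∈ U, X y = W y := by
  obtain ⟨χ, h1, hs⟩ := exists_bump (E := E) (hV.mem_nhds hx)
  obtain ⟨U, hU, hUo, hxU⟩ := eventually_nhds_iff.1 h1
  refine ⟨U, hUo, hxU, fun y hy => hs (subset_closure ?_), fun W hW => ?_⟩
  · simp [hU y hy]
  · exact ⟨⟨(χ : M → ℝ) • W,
      ContMDiffOn.smul_section_of_tsupport χ.contMDiff.contMDiffOn hV hs hW⟩,
      fun y hy => by simp [hU y hy]⟩

theorem exists_field_apply_eq {x : M} (v : TangentSpace 𝓘(ℝ, E) x) :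
    ∃ X : SmoothField E M, X x = v := by
  obtain ⟨u, hu, h⟩ := FiberBundle.exists_contMDiffOn_extend (k := ∞) 𝓘(ℝ, E) E v
  obtain ⟨V, hVu, hV, hxV⟩ := mem_nhds_iff.1 hu
  obtain ⟨U, -, hxU, -, hext⟩ := exists_nhds_extend_field (E := E) hV hxV
  obtain ⟨X, hX⟩ := hext _ (h.mono hVu)
  exact ⟨X, by simp [hX x hxU]⟩

/-- Smooth functions separate tangent vectors. -/
theorem eq_zero_of_dAt_eq_zero {x : M} {v : TangentSpace 𝓘(ℝ, E) x}
    (h : ∀ f : SmoothFunction E M, dAt f x v = 0) : v = 0 := by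
  have : IsManifold 𝓘(ℝ, E) 1 M := IsManifold.of_le (n := ∞) (by exact_mod_cast le_top)
  have hinv := isInvertible_mfderiv_extChartAt (I := 𝓘(ℝ, E))
    (mem_extChartAt_source (I := 𝓘(ℝ, E)) x)
  have hinj : Function.Injective (mfderiv 𝓘(ℝ, E) 𝓘(ℝ, E) (extChartAt 𝓘(ℝ, E) x) x) :=
    hinv.injective
  apply hinj
  rw [map_zero]
  set w : E := mfderiv 𝓘(ℝ, E) 𝓘(ℝ, E) (extChartAt 𝓘(ℝ, E) x) x v with hw
  by_contra hne
  -- The test function is a linear form detecting `w`, read in the chart and extended from a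
  -- neighbourhood of `x`.
  obtain ⟨φ, hφ⟩ := SeparatingDual.exists_ne_zero (R := ℝ) (show w ≠ 0 from hne)
  obtain ⟨U, hU, hxU, -, hext⟩ :=
    exists_nhds_extend_function (E := E) (chartAt E x).open_source (mem_chart_source E x)
  have hg : ContMDiffOn 𝓘(ℝ, E) 𝓘(ℝ, ℝ) ∞ (fun y => φ (extChartAt 𝓘(ℝ, E) x y))
      (chartAt E x).source :=
    φ.contMDiff.comp_contMDiffOn contMDiffOn_extChartAt
  obtain ⟨f, hf⟩ := hext _ hg
  have h1 := h f
  have hfe : (f : M → ℝ) =ᶠ[𝓝 x] (φ ∘ extChartAt 𝓘(ℝ, E) x) := by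
    filter_upwards [hU.mem_nhds hxU] with y hy using hf y hy
  apply hφ
  have hd : MDifferentiableAt 𝓘(ℝ, E) 𝓘(ℝ, E) (extChartAt 𝓘(ℝ, E) x) x :=
    mdifferentiableAt_extChartAt (mem_chart_source E x)
  have h2 : mfderiv 𝓘(ℝ, E) 𝓘(ℝ, ℝ) f x v =
      φ (mfderiv 𝓘(ℝ, E) 𝓘(ℝ, E) (extChartAt 𝓘(ℝ, E) x) x v) := by
    rw [hfe.mfderiv_eq, mfderiv_comp x φ.differentiableAt.mdifferentiableAt hd,
      mfderiv_eq_fderiv, φ.fderiv]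
    rfl
  rw [← h2]
  exact h1

/-- Cramer's rule: `B` is the adjugate times a global function that agrees with the inverse of the
determinant near `x`. -/
theorem exists_nhds_matrix_inverse {ι : Type*} [Fintype ι] [DecidableEq ι]
    (A : Matrix ι ι (SmoothFunction E M)) {x : M} (hA : ((evalAt x).mapMatrix A).det ≠ 0) :
    ∃ U : Set M, IsOpen U ∧ x ∈ U ∧ ∃ B : Matrix ι ι (SmoothFunction E M),
      ∀ y ∈ U, (evalAt y).mapMatrix A * (evalAt y).mapMatrix B = 1 := by
  have hdet : ∀ y, ((evalAt y).mapMatrix A).det = A.det y := fun y => by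
    rw [← RingHom.map_det]; rfl
  rw [hdet] at hA
  have hV : IsOpen {y | A.det y ≠ 0} := isOpen_ne_fun A.det.contMDiff.continuous continuous_const
  obtain ⟨U, hU, hxU, hUV, hext⟩ := exists_nhds_extend_function (E := E) hV hA
  obtain ⟨g, hg⟩ := hext (fun y => (A.det y)⁻¹)
    (A.det.contMDiff.contMDiffOn.inv₀ fun y hy => hy)
  refine ⟨U, hU, hxU, g • A.adjugate, fun y hy => ?_⟩
  rw [← map_mul, Matrix.mul_smul, Matrix.mul_adjugate, smul_smul]
  ext i j
  have : g y * A.det y = 1 := by rw [hg y hy]; exact inv_mul_cancel₀ (hUV hy)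
  have h2 : evalAt y (g * A.det) = 1 := this
  simp only [RingHom.mapMatrix_apply, Matrix.map_apply, Matrix.smul_apply, smul_eq_mul, map_mul,
    Matrix.one_apply] at h2 ⊢
  rw [h2, one_mul]
  split_ifs <;> simp

end Localization

/-! ### Algebra of the Lie bracket of smooth fields. -/

section Bracket

variable {E : Type*} [NormedAddCommGroup E] [NormedSpace ℝ E]
  {M : Type*} [TopologicalSpace M] [ChartedSpace E M] [IsManifold 𝓘(ℝ, E) ∞ M]
  [FiniteDimensional ℝ E]

theorem fieldBracket_congr {X X' Y Y' : SmoothField E M} {x : M}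
    (hX : ∀ᶠ y in 𝓝 x, X y = X' y) (hY : ∀ᶠ y in 𝓝 x, Y y = Y' y) :
    fieldBracket X Y x = fieldBracket X' Y' x :=
  Filter.EventuallyEq.mlieBracket_vectorField_eq hX hY

theorem fieldBracket_swap (X Y : SmoothField E M) : fieldBracket X Y = -fieldBracket Y X := by
  ext x
  exact mlieBracket_swap_apply

theorem fieldBracket_self (X : SmoothField E M) : fieldBracket X X = 0 := by
  ext x
  change mlieBracket 𝓘(ℝ, E) X X x = 0
  simp

theorem fieldBracket_add_right (X Y Z : SmoothField E M) :
    fieldBracket X (Y + Z) = fieldBracket X Y + fieldBracket X Z := by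
  have : CompleteSpace E := FiniteDimensional.complete ℝ E
  ext x
  exact mlieBracket_add_right (mdiff_field Y x) (mdiff_field Z x)

theorem fieldBracket_const_smul_right (c : ℝ) (X Y : SmoothField E M) :
    fieldBracket X (c • Y) = c • fieldBracket X Y := by
  have : CompleteSpace E := FiniteDimensional.complete ℝ E
  ext x
  exact mlieBracket_const_smul_right (mdiff_field Y x)

theorem fieldBracket_smul_right_apply (f : SmoothFunction E M) (X Y : SmoothField E M) (x : M) :
    fieldBracket X (smulField f Y) x = dAt f x (X x) • Y x + f x • fieldBracket X Y x := by
  have : CompleteSpace E := FiniteDimensional.complete ℝ E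
  exact mlieBracket_smul_right (mdiff_function f x) (mdiff_field Y x)

variable (E M) in
/-- The Lie bracket as a bilinear map. -/
def bracketBilin : SmoothField E M →ₗ[ℝ] SmoothField E M →ₗ[ℝ] SmoothField E M :=
  LinearMap.mk₂ ℝ fieldBracket
    (fun X Y Z => by
      rw [fieldBracket_swap, fieldBracket_add_right, fieldBracket_swap X, fieldBracket_swap Y]
      abel)
    (fun c X Y => by
      rw [fieldBracket_swap, fieldBracket_const_smul_right, fieldBracket_swap X, smul_neg])
    (fun X Y Z => fieldBracket_add_right X Y Z)
    (fun c X Y => fieldBracket_const_smul_right c X Y)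

theorem bracketBilin_apply (X Y : SmoothField E M) : bracketBilin E M X Y = fieldBracket X Y := rfl

theorem fieldBracket_smul_left_apply (f : SmoothFunction E M) (X Y : SmoothField E M) (x : M) :
    fieldBracket (smulField f X) Y x = -dAt f x (Y x) • X x + f x • fieldBracket X Y x := by
  rw [fieldBracket_swap, ContMDiffSection.coe_neg, Pi.neg_apply, fieldBracket_smul_right_apply,
    fieldBracket_swap X, ContMDiffSection.coe_neg, Pi.neg_apply]
  module

end Bracket

/-! ### Local frames by global fields, and tensoriality. -/

section Frames

variable {E : Type*} [NormedAddCommGroup E] [NormedSpace ℝ E]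
  {M : Type*} [TopologicalSpace M] [ChartedSpace E M] [IsManifold 𝓘(ℝ, E) ∞ M]
  [FiniteDimensional ℝ E] [T2Space M]

theorem exists_coordinate_frame {ι : Type*} [Fintype ι] (b : Module.Basis ι ℝ E) (x : M) :
    ∃ (D : ι → SmoothField E M) (U : Set M), IsOpen U ∧ x ∈ U ∧
      ∀ Y : SmoothField E M, ∃ a : ι → SmoothFunction E M,
        ∀ y ∈ U, Y y = ∑ i, a i y • D i y := by
  set e := trivializationAt E (TangentSpace 𝓘(ℝ, E) : M → Type _) x with he
  have hx : x ∈ e.baseSet := FiberBundle.mem_baseSet_trivializationAt' x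
  obtain ⟨U, hU, hxU, hUV, hext⟩ := exists_nhds_extend_field (E := E) e.open_baseSet hx
  obtain ⟨U', hU', hxU', -, hext'⟩ := exists_nhds_extend_function (E := E) e.open_baseSet hx
  choose D hD using fun i => hext (e.localFrame b i)
    (e.contMDiffOn_localFrame_baseSet (I := 𝓘(ℝ, E)) ∞ b i)
  refine ⟨D, U ∩ U', hU.inter hU', ⟨hxU, hxU'⟩, fun Y => ?_⟩
  choose a ha using fun i => hext' _
    (contMDiffOn_localFrameCoeff (e := e) (k := ∞) b e.open_baseSet subset_rfl
      Y.contMDiff.contMDiffOn i)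
  refine ⟨a, fun y hy => ?_⟩
  rw [e.eq_sum_localFrameCoeff_smul (I := 𝓘(ℝ, E)) (b := b) (s := Y) (hUV hy.1)]
  refine Finset.sum_congr rfl fun i _ => ?_
  rw [ha i y hy.2, hD i y hy.1]
  rfl

theorem linearIndependent_of_expansion {ι : Type*} [Fintype ι]
    (hcard : Fintype.card ι = Module.finrank ℝ E) {G : ι → SmoothField E M} {y : M}
    (h : ∀ Y : SmoothField E M, ∃ a : ι → SmoothFunction E M, Y y = ∑ i, a i y • G i y) :
    LinearIndependent ℝ (fun i => G i y) := by
  refine linearIndependent_of_top_le_span_of_card_eq_finrank (fun v _ => ?_) hcard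
  obtain ⟨Y, rfl⟩ := exists_field_apply_eq v
  obtain ⟨a, ha⟩ := h Y
  rw [ha]
  exact Submodule.sum_mem _ fun i _ => Submodule.smul_mem _ _ (Submodule.subset_span ⟨i, rfl⟩)

/-- Vector fields whose values at `x` form a basis are a smooth frame near `x`. -/
theorem exists_nhds_frame_expansion {ι : Type*} [Fintype ι]
    (hcard : Fintype.card ι = Module.finrank ℝ E) {G : ι → SmoothField E M} {x : M}
    (hG : LinearIndependent ℝ (fun i => G i x)) :
    ∃ U : Set M, IsOpen U ∧ x ∈ U ∧
      ∀ Y : SmoothField E M, ∃ a : ι → SmoothFunction E M,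
        ∀ y ∈ U, Y y = ∑ i, a i y • G i y := by
  classical
  obtain ⟨D, U, hU, hxU, hD⟩ := exists_coordinate_frame
    ((Module.finBasis ℝ E).reindex (Fintype.equivOfCardEq (by simp [hcard]) : _ ≃ ι)) x
  choose A hA using fun j => hD (G j)
  -- A kernel vector of the transition matrix at `x` would be a linear relation among the `G j x`.
  have hdet : ((evalAt x).mapMatrix (Matrix.of fun i j => A j i)).det ≠ 0 := by
    intro h0
    obtain ⟨c, hc, hAc⟩ := Matrix.exists_mulVec_eq_zero_iff.2 h0
    refine hc (funext (Fintype.linearIndependent_iff.1 hG c ?_))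
    simp_rw [hA _ x hxU, Finset.smul_sum]
    rw [Finset.sum_comm]
    refine Finset.sum_eq_zero fun i _ => ?_
    have h1 : ∑ j, A j i x * c j = 0 := congrFun hAc i
    simp_rw [smul_smul, ← Finset.sum_smul, mul_comm (c _), h1, zero_smul]
  obtain ⟨V, hV, hxV, B, hB⟩ := exists_nhds_matrix_inverse _ hdet
  refine ⟨U ∩ V, hU.inter hV, ⟨hxU, hxV⟩, fun Y => ?_⟩
  obtain ⟨a, ha⟩ := hD Y
  refine ⟨fun j => ∑ i, B j i * a i, fun y hy => ?_⟩
  have hDG : ∀ i, D i y = ∑ j, B j i y • G j y := by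
    intro i
    simp_rw [hA _ y hy.1, Finset.smul_sum]
    rw [Finset.sum_comm]
    have h1 : ∀ k, ∑ j, A j k y * B j i y = if k = i then 1 else 0 := fun k => by
      simpa [Matrix.mul_apply, Matrix.one_apply, evalAt_apply] using
          congrFun (congrFun (hB y hy.2) k) i
    simp_rw [smul_smul, ← Finset.sum_smul, mul_comm (B _ i y), h1]
    simp
  have hsum : ∀ j, (∑ i, B j i * a i : SmoothFunction E M) y = ∑ i, B j i y * a i y := fun j =>
    map_sum (evalAt y) _ _
  simp_rw [hsum, ha y hy.1, hDG, Finset.smul_sum, Finset.sum_smul, smul_smul]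
  rw [Finset.sum_comm]
  simp_rw [mul_comm]

/-- For a bump function `χ` supported where `X` vanishes, `χ X = 0`, whereas `T (χ X) = χ(x) T X = T
X`. -/
theorem map_eq_zero_of_eventually_eq_zero {V : Type*} [AddCommGroup V] [Module ℝ V]
    {T : SmoothField E M →ₗ[ℝ] V} {x : M} (hT : ∀ f X, T (smulField f X) = f x • T X)
    {X : SmoothField E M} (h : ∀ᶠ y in 𝓝 x, X y = 0) : T X = 0 := by
  obtain ⟨χ, h1, hs⟩ := exists_bump (E := E) h
  have hX : smulField χ X = 0 := by
    ext y
    by_cases hy : y ∈ tsupport χ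
    · simp [show X y = 0 from hs hy]
    · simp [image_eq_zero_of_notMem_tsupport hy]
  have h2 := hT χ X
  rwa [hX, map_zero, h1.self_of_nhds, one_smul, eq_comm] at h2

/-- A linear map on vector fields which is `C^∞(M)`-linear over evaluation at `x` only depends on
the value at `x`. -/
theorem map_eq_zero_of_apply_eq_zero {V : Type*} [AddCommGroup V] [Module ℝ V]
    {T : SmoothField E M →ₗ[ℝ] V} {x : M} (hT : ∀ f X, T (smulField f X) = f x • T X)
    {X : SmoothField E M} (h : X x = 0) : T X = 0 := by
  obtain ⟨D, U, hU, hxU, hD⟩ := exists_coordinate_frame (Module.finBasis ℝ E) x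
  obtain ⟨a, ha⟩ := hD X
  have hli := linearIndependent_of_expansion (by simp) fun Y => (hD Y).imp fun a ha => ha x hxU
  have ha0 := Fintype.linearIndependent_iff.1 hli (fun i => a i x) ((ha x hxU).symm.trans h)
  -- The frame expansion holds only near `x`, so locality of `T` comes first; then every coefficient
  -- `a i` vanishes at `x`.
  have h1 : T (X - ∑ i, smulField (a i) (D i)) = 0 := by
    refine map_eq_zero_of_eventually_eq_zero hT ?_
    filter_upwards [hU.mem_nhds hxU] with y hy
    simp [sum_field_apply, ha y hy]
  rw [map_sub, map_sum, sub_eq_zero] at h1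
  rw [h1]
  exact Finset.sum_eq_zero fun i _ => by rw [hT, ha0, zero_smul]

end Frames

/-! ### Adapted frames, the curvature, and contact vector fields. -/

section HamiltonianFields

variable {E : Type*} [NormedAddCommGroup E] [NormedSpace ℝ E]
  {M : Type*} [TopologicalSpace M] [ChartedSpace E M]

theorem mem_iff_mkQ_eq_zero {H : SubspaceField E M} {x : M} {v : TangentSpace 𝓘(ℝ, E) x} :
    v ∈ H x ↔ (H x).mkQ v = 0 := by
  simp

variable [IsManifold 𝓘(ℝ, E) ∞ M]

/-- A local frame `F₁, …, Fₙ, R` of `TM` on a neighbourhood of `x`, with all `Fᵢ` tangent to `H` and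
`R` transverse to `H`. -/
structure AdaptedFrame (H : SubspaceField E M) (x : M) where
  /-- the rank of `H` -/
  n : ℕ
  /-- the frame of `H` -/
  F : Fin n → SmoothField E M
  /-- the transverse field -/
  R : SmoothField E M
  /-- the domain of the frame -/
  U : Set M
  isOpen : IsOpen U
  mem : x ∈ U
  F_mem : ∀ i, F i ∈ tangentFields H
  R_notMem : ∀ y ∈ U, R y ∉ H y
  linearIndependent : LinearIndependent ℝ (fun i => F i x)
  /-- the coefficients along `H` -/
  coeff : SmoothField E M → Fin n → SmoothFunction E M
  /-- the transverse coefficient -/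
  trans : SmoothField E M → SmoothFunction E M
  expand : ∀ Y, ∀ y ∈ U, Y y = ∑ i, coeff Y i y • F i y + trans Y y • R y

namespace AdaptedFrame

variable {H : SubspaceField E M} {x : M} (A : AdaptedFrame H x)

theorem mkQ_apply (Y : SmoothField E M) {y : M} (hy : y ∈ A.U) :
    (H y).mkQ (Y y) = A.trans Y y • (H y).mkQ (A.R y) := by
  conv_lhs => rw [A.expand Y y hy]
  rw [map_add, map_smul, mem_iff_mkQ_eq_zero.1
    (Submodule.sum_mem _ fun i _ => Submodule.smul_mem _ _ (A.F_mem i y)), zero_add]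

theorem mkQ_R_ne_zero {y : M} (hy : y ∈ A.U) : (H y).mkQ (A.R y) ≠ 0 := fun h =>
  A.R_notMem y hy (mem_iff_mkQ_eq_zero.2 h)

theorem expand_of_mem {Y : SmoothField E M} {y : M} (hy : y ∈ A.U) (hY : Y y ∈ H y) :
    Y y = ∑ i, A.coeff Y i y • A.F i y := by
  have h := A.mkQ_apply Y hy
  rw [mem_iff_mkQ_eq_zero.1 hY, eq_comm, smul_eq_zero, or_iff_left (A.mkQ_R_ne_zero hy)] at h
  conv_lhs => rw [A.expand Y y hy, h, zero_smul, add_zero]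

theorem eventually_mem : ∀ᶠ y in 𝓝 x, y ∈ A.U := A.isOpen.mem_nhds A.mem

end AdaptedFrame

variable [FiniteDimensional ℝ E] {H : SubspaceField E M}

/-- The derivative term of the Leibniz rule is a multiple of `Z`, which dies modulo `H`. -/
theorem mkQ_bracket_smul_right {Z : SmoothField E M} (hZ : Z ∈ tangentFields H)
    (f : SmoothFunction E M) (W : SmoothField E M) (y : M) :
    (H y).mkQ (fieldBracket W (smulField f Z) y) = f y • (H y).mkQ (fieldBracket W Z y) := by
  rw [fieldBracket_smul_right_apply, map_add, map_smul, map_smul, mem_iff_mkQ_eq_zero.1 (hZ y),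
    smul_zero, zero_add]

theorem mkQ_bracket_smul_left {Z : SmoothField E M} (hZ : Z ∈ tangentFields H)
    (f : SmoothFunction E M) (W : SmoothField E M) (y : M) :
    (H y).mkQ (fieldBracket (smulField f Z) W y) = f y • (H y).mkQ (fieldBracket Z W y) := by
  rw [fieldBracket_smul_left_apply, map_add, map_smul, map_smul, mem_iff_mkQ_eq_zero.1 (hZ y),
    smul_zero, zero_add]

/-- Reduces brackets with arbitrary fields of `Γ(H)` to brackets with a frame of `H`. -/
theorem mkQ_bracket_sum_right {ι : Type*} [Fintype ι] {F : ι → SmoothField E M}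
    (hF : ∀ i, F i ∈ tangentFields H) {a : ι → SmoothFunction E M} {Z : SmoothField E M} {y : M}
    (h : ∀ᶠ z in 𝓝 y, Z z = ∑ i, a i z • F i z) (W : SmoothField E M) :
    (H y).mkQ (fieldBracket W Z y) = ∑ i, a i y • (H y).mkQ (fieldBracket W (F i) y) := by
  have h' : ∀ᶠ z in 𝓝 y, Z z = (∑ i, smulField (a i) (F i)) z := by
    filter_upwards [h] with z hz
    simp [hz, sum_field_apply]
  rw [fieldBracket_congr (Filter.Eventually.of_forall fun _ => rfl) h', ← bracketBilin_apply,
    map_sum, sum_field_apply, map_sum]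
  exact Finset.sum_congr rfl fun i _ => mkQ_bracket_smul_right (hF i) _ _ _

theorem mkQ_bracket_swap (X Y : SmoothField E M) (y : M) :
    (H y).mkQ (fieldBracket X Y y) = -(H y).mkQ (fieldBracket Y X y) := by
  rw [fieldBracket_swap, ContMDiffSection.coe_neg, Pi.neg_apply, map_neg]

/-- A vector `c` in the left kernel would make `∑ c i • A.F i`, with constant coefficients, a field
in the radical of the curvature at `x`. -/
theorem IsContactStructure.det_curvature_ne_zero (hH : IsContactStructure H) {x : M}
    (A : AdaptedFrame H x) :
    ((evalAt x).mapMatrix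
      (Matrix.of fun i j => A.trans (fieldBracket (A.F i) (A.F j)))).det ≠ 0 := by
  intro h0
  obtain ⟨c, hc, hAc⟩ := Matrix.exists_vecMul_eq_zero_iff.2 h0
  have hZ : ∑ i, c i • A.F i ∈ tangentFields H :=
    Submodule.sum_mem _ fun i _ => Submodule.smul_mem _ _ (A.F_mem i)
  have hZx := hH.nondegenerate x _ hZ fun W hW => by
    have hexp : ∀ᶠ z in 𝓝 x, W z = ∑ i, A.coeff W i z • A.F i z := by
      filter_upwards [A.eventually_mem] with z h2 using A.expand_of_mem h2 (hW z)
    rw [mkQ_bracket_sum_right A.F_mem hexp]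
    refine Finset.sum_eq_zero fun j _ => ?_
    have h1 : ∑ i, c i * A.trans (fieldBracket (A.F i) (A.F j)) x = 0 := congrFun hAc j
    rw [← bracketBilin_apply, map_sum, LinearMap.sum_apply, sum_field_apply, map_sum]
    simp only [map_smul, LinearMap.smul_apply, bracketBilin_apply, ContMDiffSection.coe_smul,
      Pi.smul_apply]
    have hK : ∀ i, (H x).mkQ (fieldBracket (A.F i) (A.F j) x) =
        A.trans (fieldBracket (A.F i) (A.F j)) x • (H x).mkQ (A.R x) :=
      fun i => A.mkQ_apply _ A.mem
    simp_rw [hK, smul_smul, ← Finset.sum_smul, h1, zero_smul, smul_zero]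
  rw [sum_field_apply] at hZx
  exact hc (funext (Fintype.linearIndependent_iff.1 A.linearIndependent c hZx))

variable [T2Space M]

/-- A field tangent to `H` near `y` agrees near `y` with a field tangent to `H`. -/
theorem exists_tangentField_eventually_eq {Z : SmoothField E M} {y : M}
    (hZ : ∀ᶠ z in 𝓝 y, Z z ∈ H z) : ∃ Z' ∈ tangentFields H, ∀ᶠ z in 𝓝 y, Z z = Z' z := by
  obtain ⟨χ, h1, hs⟩ := exists_bump (E := E) hZ
  refine ⟨smulField χ Z, fun z => ?_, ?_⟩
  · by_cases hz : z ∈ tsupport χ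
    · exact (H z).smul_mem _ (hs hz)
    · simp [image_eq_zero_of_notMem_tsupport hz]
  · filter_upwards [h1] with z hz
    simp [hz]

theorem IsContactStructure.nonempty_adaptedFrame (hH : IsContactStructure H) (x : M) :
    Nonempty (AdaptedFrame H x) := by
  set b := Module.finBasis ℝ (H x)
  choose F hF hFx using fun i => hH.smooth x (b i) (b i).2
  obtain ⟨v, hv⟩ : ∃ v, v ∉ H x := by
    by_contra! hall
    have h1 := hH.corank_one x
    have : Subsingleton (NormalFibre H x) :=
      Submodule.Quotient.subsingleton_iff.2 ((Submodule.eq_top_iff').2 hall)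
    rw [Module.finrank_zero_of_subsingleton] at h1
    exact zero_ne_one h1
  obtain ⟨R, rfl⟩ := exists_field_apply_eq v
  have hFb : (fun i => F i x) = fun i => ((b i : H x) : TangentSpace 𝓘(ℝ, E) x) := funext hFx
  have hli : LinearIndependent ℝ (fun i => F i x) := by
    rw [hFb]
    exact b.linearIndependent.map' (H x).subtype (Submodule.ker_subtype _)
  have hG : LinearIndependent ℝ (fun i => (Fin.cons R F : Fin (_ + 1) → SmoothField E M) i x) := by
    have : (fun i => (Fin.cons R F : Fin (_ + 1) → SmoothField E M) i x) =
        Fin.cons (R x) (fun i => F i x) := by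
      funext i
      refine Fin.cases rfl (fun _ => rfl) i
    rw [this, linearIndependent_finCons]
    refine ⟨hli, fun h => hv (Submodule.span_le.2 ?_ h)⟩
    rintro _ ⟨i, rfl⟩
    exact hF i x
  have hcard : Fintype.card (Fin (Module.finrank ℝ (H x) + 1)) = Module.finrank ℝ E := by
    rw [Fintype.card_fin, ← finrank_tangentSpace (E := E) x,
      ← Submodule.finrank_quotient_add_finrank (H x)]
    rw [show Module.finrank ℝ (TangentSpace 𝓘(ℝ, E) x ⧸ H x) = 1 from hH.corank_one x, add_comm]
  obtain ⟨U, hU, hxU, hexp⟩ := exists_nhds_frame_expansion hcard hG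
  choose a ha using hexp
  have hexp' : ∀ Y, ∀ y ∈ U, Y y = ∑ i, a Y (Fin.succ i) y • F i y + a Y 0 y • R y := by
    intro Y y hy
    rw [ha Y y hy, Fin.sum_univ_succ, add_comm]
    rfl
  refine ⟨⟨_, F, R, U, hU, hxU, hF, fun y hy hR => ?_, hli, _, _, hexp'⟩⟩
  -- If `R y` were in `H y`, the whole frame would lie in `H y` and the quotient would be zero.
  have h1 := hH.corank_one y
  have : Subsingleton (NormalFibre H y) := by
    refine Submodule.Quotient.subsingleton_iff.2 ((Submodule.eq_top_iff').2 fun w => ?_)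
    obtain ⟨Y, rfl⟩ := exists_field_apply_eq w
    rw [hexp' Y y hy]
    exact (H y).add_mem (Submodule.sum_mem _ fun i _ => Submodule.smul_mem _ _ (hF i y))
      (Submodule.smul_mem _ _ hR)
  rw [Module.finrank_zero_of_subsingleton] at h1
  exact zero_ne_one h1

/-- An adapted frame of a contact structure. -/
def IsContactStructure.adaptedFrame (hH : IsContactStructure H) (x : M) : AdaptedFrame H x :=
  Classical.choice (hH.nonempty_adaptedFrame x)

/-- The curvature is tensorial. -/
theorem IsContactStructure.mkQ_bracket_eq_zero (hH : IsContactStructure H) {x : M}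
    {Z : SmoothField E M} (hZ : ∀ᶠ z in 𝓝 x, Z z ∈ H z) (hx : Z x = 0) (W : SmoothField E M) :
    (H x).mkQ (fieldBracket W Z x) = 0 := by
  set A := hH.adaptedFrame x
  have hexp : ∀ᶠ z in 𝓝 x, Z z = ∑ i, A.coeff Z i z • A.F i z := by
    filter_upwards [hZ, A.eventually_mem] with z h1 h2 using A.expand_of_mem h2 h1
  have h0 := Fintype.linearIndependent_iff.1 A.linearIndependent (fun i => A.coeff Z i x)
    (hexp.self_of_nhds.symm.trans hx)
  rw [mkQ_bracket_sum_right A.F_mem hexp]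
  exact Finset.sum_eq_zero fun i _ => by rw [h0, zero_smul]

/-- Vector fields which are infinitesimal symmetries of `H` at `y` have the same value at `y` when
they have the same class modulo `H` near `y`. -/
theorem IsContactStructure.apply_eq_of_mkQ_eq (hH : IsContactStructure H) {X X' : SmoothField E M}
    {y : M} (h : ∀ᶠ z in 𝓝 y, (H z).mkQ (X z) = (H z).mkQ (X' z))
    (hX : ∀ W ∈ tangentFields H, fieldBracket X W y ∈ H y)
    (hX' : ∀ W ∈ tangentFields H, fieldBracket X' W y ∈ H y) : X y = X' y := by
  have hZ : ∀ᶠ z in 𝓝 y, (X - X') z ∈ H z := by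
    filter_upwards [h] with z hz
    rw [mem_iff_mkQ_eq_zero, ContMDiffSection.coe_sub, Pi.sub_apply, map_sub, hz, sub_self]
  -- Non-degeneracy is tested on fields tangent to `H` everywhere; the difference is so only near
  -- `y`.
  obtain ⟨Z, hZH, hZe⟩ := exists_tangentField_eventually_eq hZ
  have h0 := hH.nondegenerate y Z hZH fun W hW => by
    rw [← fieldBracket_congr hZe (Filter.Eventually.of_forall fun _ => rfl),
      ← bracketBilin_apply, map_sub, LinearMap.sub_apply, ← mem_iff_mkQ_eq_zero]
    exact (H y).sub_mem (hX W hW) (hX' W hW)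
  rw [← hZe.self_of_nhds] at h0
  exact sub_eq_zero.1 h0

/-- Correct a lift `Y` by a field `∑ z i F i` of `H`: modulo `H`, the bracket with `F j` vanishes
exactly when `z K` is the row of transverse coefficients of the `[Y, F j]`, where `K` is the
curvature matrix. -/
theorem IsContactStructure.exists_local_contactField (hH : IsContactStructure H)
    (s : normalSections H) (x : M) :
    ∃ X : SmoothField E M, ∀ᶠ y in 𝓝 x,
      s.1 y = (H y).mkQ (X y) ∧ ∀ W ∈ tangentFields H, fieldBracket X W y ∈ H y := by
  obtain ⟨Y, hY⟩ := s.2 x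
  set A := hH.adaptedFrame x
  obtain ⟨V, hV, hxV, B, hB⟩ := exists_nhds_matrix_inverse _ (hH.det_curvature_ne_zero A)
  -- The solution of that system, with `B` the inverse of the curvature matrix near `x`.
  set z : Fin A.n → SmoothFunction E M :=
    fun i => ∑ j, A.trans (fieldBracket Y (A.F j)) * B j i with hz
  refine ⟨Y - ∑ i, smulField (z i) (A.F i), ?_⟩
  filter_upwards [hY, A.eventually_mem, hV.mem_nhds hxV] with y hsy hyU hyV
  constructor
  · rw [hsy, ContMDiffSection.coe_sub, Pi.sub_apply, map_sub, sum_field_apply]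
    rw [mem_iff_mkQ_eq_zero.1 (Submodule.sum_mem _ fun i _ => (H y).smul_mem _ (A.F_mem i y) :
      ∑ i, smulField (z i) (A.F i) y ∈ H y), sub_zero]
  · intro W hW
    have hexp : ∀ᶠ z in 𝓝 y, W z = ∑ i, A.coeff W i z • A.F i z := by
      filter_upwards [A.isOpen.mem_nhds hyU] with z h2 using A.expand_of_mem h2 (hW z)
    rw [mem_iff_mkQ_eq_zero, mkQ_bracket_sum_right A.F_mem hexp]
    refine Finset.sum_eq_zero fun j _ => ?_
    rw [← bracketBilin_apply, map_sub, map_sum, LinearMap.sub_apply, LinearMap.sum_apply,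
      ContMDiffSection.coe_sub, Pi.sub_apply, map_sub, sum_field_apply, map_sum]
    have hK : ∀ i, (H y).mkQ (fieldBracket (A.F i) (A.F j) y) =
        A.trans (fieldBracket (A.F i) (A.F j)) y • (H y).mkQ (A.R y) :=
      fun i => A.mkQ_apply _ hyU
    simp_rw [bracketBilin_apply, mkQ_bracket_smul_left (A.F_mem _), hK, smul_smul]
    rw [A.mkQ_apply (fieldBracket Y (A.F j)) hyU]
    simp_rw [← Finset.sum_smul, ← sub_smul]
    -- `B` was produced as a right inverse of the curvature matrix; the system for `z` needs a left
    -- one.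
    have hBK := mul_eq_one_comm.1 (hB y hyV)
    have hzK : ∑ i, z i y * A.trans (fieldBracket (A.F i) (A.F j)) y =
        A.trans (fieldBracket Y (A.F j)) y := by
      have h1 : ∀ k, ∑ i, B k i y * A.trans (fieldBracket (A.F i) (A.F j)) y =
          if k = j then 1 else 0 := fun k => by
        simpa [Matrix.mul_apply, Matrix.one_apply, evalAt_apply] using
          congrFun (congrFun hBK k) j
      have h2 : ∀ i, z i y = ∑ k, A.trans (fieldBracket Y (A.F k)) y * B k i y := fun i =>
        map_sum (evalAt y) _ _
      simp_rw [h2, Finset.sum_mul]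
      rw [Finset.sum_comm]
      simp_rw [mul_assoc, ← Finset.mul_sum, h1]
      simp
    rw [hzK, sub_self, zero_smul, smul_zero]

/-- By pointwise uniqueness, the local solution around `x` and the one around a nearby `y` have the
same value at `y`, so the diagonal `y ↦ X y y` is smooth and agrees near each point with a local
solution. -/
theorem IsContactStructure.existsUnique_contactField (hH : IsContactStructure H)
    (s : normalSections H) :
    ∃! X : SmoothField E M, IsContactField H X ∧ theta H X = s := by
  choose X hX using hH.exists_local_contactField s
  have key : ∀ x, ∀ᶠ y in 𝓝 x, X y y = X x y := by
    intro x
    filter_upwards [(hX x).eventually_nhds] with y hy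
    have h1 := hX y
    refine hH.apply_eq_of_mkQ_eq ?_ h1.self_of_nhds.2 hy.self_of_nhds.2
    filter_upwards [h1, hy] with z hz hz'
    rw [← hz.1, ← hz'.1]
  let X₀ : SmoothField E M := ⟨fun y => X y y, fun x => by
    refine (X x).contMDiff.contMDiffAt.congr_of_eventuallyEq ?_
    filter_upwards [key x] with y hy
    rw [hy]⟩
  have hX₀ : ∀ x, ∀ᶠ y in 𝓝 x, X₀ y = X x y := key
  refine ⟨X₀, ⟨fun W hW x => ?_, ?_⟩, fun X' hX' => ?_⟩
  · rw [fieldBracket_congr (hX₀ x) (Filter.Eventually.of_forall fun _ => rfl)]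
    exact (hX x).self_of_nhds.2 W hW
  · ext x
    exact (hX x).self_of_nhds.1.symm
  · ext x
    refine hH.apply_eq_of_mkQ_eq ?_ (fun W hW => hX'.1 W hW x) fun W hW => ?_
    · filter_upwards [hX₀ x, hX x] with z h1 h2
      rw [h1, ← h2.1, ← hX'.2]
      rfl
    · rw [fieldBracket_congr (hX₀ x) (Filter.Eventually.of_forall fun _ => rfl)]
      exact (hX x).self_of_nhds.2 W hW

end HamiltonianFields

/-! ### Non-degenerate pairings with values in a line. -/

section LineValuedPairings

variable {V W L : Type*} [AddCommGroup V] [Module ℝ V] [AddCommGroup W] [Module ℝ W]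
  [AddCommGroup L] [Module ℝ L]

theorem finiteDimensional_of_finrank_eq_one (hL : Module.finrank ℝ L = 1) :
    FiniteDimensional ℝ L :=
  Module.finite_of_finrank_pos (by rw [hL]; exact one_pos)

theorem finrank_hom_of_finrank_eq_one (hL : Module.finrank ℝ L = 1) [FiniteDimensional ℝ W] :
    Module.finrank ℝ (W →ₗ[ℝ] L) = Module.finrank ℝ W := by
  have := finiteDimensional_of_finrank_eq_one hL
  rw [Module.finrank_linearMap, hL, mul_one]

theorem finiteDimensional_of_lineValued_nondegenerate (hL : Module.finrank ℝ L = 1)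
    [FiniteDimensional ℝ W] {B : V →ₗ[ℝ] W →ₗ[ℝ] L} (hB : Function.Injective B) :
    FiniteDimensional ℝ V :=
  have := finiteDimensional_of_finrank_eq_one hL
  FiniteDimensional.of_injective B hB

/-- Maps into a line form a space of the same dimension as the source, so the two injections give
the two inequalities. -/
theorem finrank_eq_of_lineValued_nondegenerate (hL : Module.finrank ℝ L = 1)
    [FiniteDimensional ℝ W] {B : V →ₗ[ℝ] W →ₗ[ℝ] L} (hB : Function.Injective B)
    (hB' : Function.Injective B.flip) : Module.finrank ℝ V = Module.finrank ℝ W := by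
  have := finiteDimensional_of_finrank_eq_one hL
  have := finiteDimensional_of_lineValued_nondegenerate hL hB
  refine le_antisymm ?_ ?_
  · rw [← finrank_hom_of_finrank_eq_one (W := W) hL]
    exact LinearMap.finrank_le_finrank_of_injective hB
  · rw [← finrank_hom_of_finrank_eq_one (W := V) hL]
    exact LinearMap.finrank_le_finrank_of_injective hB'

theorem bijective_of_lineValued_nondegenerate (hL : Module.finrank ℝ L = 1)
    [FiniteDimensional ℝ W] {B : V →ₗ[ℝ] W →ₗ[ℝ] L} (hB : Function.Injective B)
    (hB' : Function.Injective B.flip) : Function.Bijective B := by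
  have := finiteDimensional_of_finrank_eq_one hL
  have := finiteDimensional_of_lineValued_nondegenerate hL hB
  refine ⟨hB, (LinearMap.injective_iff_surjective_of_finrank_eq_finrank ?_).1 hB⟩
  rw [finrank_hom_of_finrank_eq_one hL, finrank_eq_of_lineValued_nondegenerate hL hB hB']

theorem flip_bijective_of_lineValued_nondegenerate (hL : Module.finrank ℝ L = 1)
    [FiniteDimensional ℝ W] {B : V →ₗ[ℝ] W →ₗ[ℝ] L} (hB : Function.Injective B)
    (hB' : Function.Injective B.flip) : Function.Bijective B.flip :=
  have := finiteDimensional_of_lineValued_nondegenerate hL hB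
  bijective_of_lineValued_nondegenerate hL hB' (by rwa [LinearMap.flip_flip])

end LineValuedPairings

/-! ### Local generators of `L` and the duality of jets and derivations. -/

section Pairing

variable {E : Type*} [NormedAddCommGroup E] [NormedSpace ℝ E]
  {M : Type*} [TopologicalSpace M] [ChartedSpace E M] [IsManifold 𝓘(ℝ, E) ∞ M]
  {H : SubspaceField E M}

theorem theta_apply (X : SmoothField E M) (y : M) : (theta H X).1 y = (H y).mkQ (X y) := rfl

theorem smulSection_apply (f : SmoothFunction E M) (s : normalSections H) (y : M) :
    (smulSection f s).1 y = f y • s.1 y := rfl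

theorem theta_smulField (f : SmoothFunction E M) (X : SmoothField E M) :
    theta H (smulField f X) = smulSection f (theta H X) := by
  ext y
  exact map_smul _ _ _

theorem jet_surjective (x : M) : Function.Surjective (jet (H := H) x) :=
  Submodule.mkQ_surjective _

variable (H) in
/-- The section `ρ` generates `L` near `x`. -/
structure IsLocalGenerator (x : M) (ρ : normalSections H) : Prop where
  ne_zero : ∀ᶠ y in 𝓝 x, ρ.1 y ≠ 0
  exists_coeff : ∀ s : normalSections H, ∃ f : SmoothFunction E M,
    ∀ᶠ y in 𝓝 x, s.1 y = f y • ρ.1 y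

theorem IsLocalGenerator.apply_ne_zero {x : M} {ρ : normalSections H}
    (hρ : IsLocalGenerator H x ρ) : ρ.1 x ≠ 0 := hρ.ne_zero.self_of_nhds

theorem IsLocalGenerator.coeff_unique {x : M} {ρ : normalSections H}
    (hρ : IsLocalGenerator H x ρ) {f g : SmoothFunction E M}
    (h : ∀ᶠ y in 𝓝 x, f y • ρ.1 y = g y • ρ.1 y) : ∀ᶠ y in 𝓝 x, f y = g y := by
  filter_upwards [h, hρ.ne_zero] with y h1 h2 using smul_left_injective ℝ h2 h1

theorem smulSection_bump_eq_zero {χ : SmoothFunction E M} {s : normalSections H}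
    (hs : tsupport χ ⊆ {y | s.1 y = 0}) : smulSection χ s = 0 := by
  ext y
  rw [smulSection_apply]
  by_cases hy : y ∈ tsupport χ
  · rw [hs hy, smul_zero]; rfl
  · rw [image_eq_zero_of_notMem_tsupport hy, zero_smul]; rfl

/-- A derivation at `x` may be prescribed freely by its symbol `v` and its value `w` on `ρ`. -/
theorem IsLocalGenerator.exists_derivation {x : M} {ρ : normalSections H}
    (hρ : IsLocalGenerator H x ρ) (v : TangentSpace 𝓘(ℝ, E) x) (w : NormalFibre H x) :
    ∃ δ : derivationFibre H x, ∀ (s : normalSections H) (f : SmoothFunction E M),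
      (∀ᶠ y in 𝓝 x, s.1 y = f y • ρ.1 y) → δ.1.1 s = dAt f x v • ρ.1 x + f x • w := by
  choose c hc using hρ.exists_coeff
  -- The coefficients `c s` are arbitrary choices, but their germs at `x` are unique, so the formula
  -- is independent of them; linearity and the Leibniz rule follow by choosing convenient
  -- coefficients.
  have key : ∀ (s : normalSections H) (f : SmoothFunction E M),
      (∀ᶠ y in 𝓝 x, s.1 y = f y • ρ.1 y) →
        dAt (c s) x v • ρ.1 x + c s x • w = dAt f x v • ρ.1 x + f x • w := by
    intro s f hf
    have h : ∀ᶠ y in 𝓝 x, c s y = f y := by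
      refine hρ.coeff_unique ?_
      filter_upwards [hf, hc s] with y h1 h2
      rw [← h1, h2]
    rw [dAt_congr h, h.self_of_nhds]
  let L : normalSections H →ₗ[ℝ] NormalFibre H x :=
    { toFun := fun s => dAt (c s) x v • ρ.1 x + c s x • w
      map_add' := fun s t => by
        rw [key (s + t) (c s + c t), dAt_add]
        · change _ + (c s x + c t x) • w = _
          module
        · filter_upwards [hc s, hc t] with y h1 h2
          change s.1 y + t.1 y = (c s y + c t y) • _
          rw [h1, h2, add_smul]
      map_smul' := fun r s => by
        rw [key (r • s) (ContMDiffMap.const r * c s), dAt_mul,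
          dAt_eq_zero_of_eventually_const (f := ContMDiffMap.const r) (c := r)
            (Filter.Eventually.of_forall fun _ => rfl)]
        · change (r * dAt (c s) x v + c s x * 0) • _ + (r * c s x) • w = r • _
          module
        · filter_upwards [hc s] with y h1
          change r • s.1 y = (r * c s y) • _
          rw [h1, mul_smul] }
  refine ⟨⟨(L, v), fun f s => ?_⟩, key⟩
  change dAt (c (smulSection f s)) x v • ρ.1 x + c (smulSection f s) x • w =
    dAt f x v • s.1 x + f x • (dAt (c s) x v • ρ.1 x + c s x • w)
  rw [key _ (f * c s), dAt_mul, (hc s).self_of_nhds]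
  · change _ + (f x * c s x) • w = _
    module
  · filter_upwards [hc s] with y h1
    change f y • s.1 y = (f y * c s y) • _
    rw [h1, mul_smul]

variable [FiniteDimensional ℝ E] [T2Space M]

/-- Locality: with `χ (s - t) = 0` and `χ = 1` at `x`, the Leibniz rule leaves only `δ (s - t)`. -/
theorem derivationFibre_congr {x : M} (δ : derivationFibre H x) {s t : normalSections H}
    (h : ∀ᶠ y in 𝓝 x, s.1 y = t.1 y) : δ.1.1 s = δ.1.1 t := by
  have h' : ∀ᶠ y in 𝓝 x, (s - t).1 y = 0 := by
    filter_upwards [h] with y hy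
    rw [Submodule.coe_sub, Pi.sub_apply, hy, sub_self]
  obtain ⟨χ, h1, hs⟩ := exists_bump (E := E) h'
  have h2 := δ.2 χ (s - t)
  rw [smulSection_bump_eq_zero hs, h1.self_of_nhds, h'.self_of_nhds, smul_zero, zero_add, one_smul,
    map_zero, map_sub] at h2
  exact (sub_eq_zero.1 h2.symm)

theorem derivationFibre_apply {x : M} (δ : derivationFibre H x) {s ρ : normalSections H}
    {f : SmoothFunction E M} (h : ∀ᶠ y in 𝓝 x, s.1 y = f y • ρ.1 y) :
    δ.1.1 s = dAt f x δ.1.2 • ρ.1 x + f x • δ.1.1 ρ := by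
  rw [derivationFibre_congr δ (t := smulSection f ρ) h, δ.2]

/-- If `χ s = 0` with `χ = 1` near `x`, then `s = (1 - χ) s`, and `1 - χ` vanishes near `x`. -/
theorem mem_vanishingJets_of_eventually_eq_zero {x : M} {s : normalSections H}
    (h : ∀ᶠ y in 𝓝 x, s.1 y = 0) : s ∈ vanishingJets H x := by
  obtain ⟨χ, h1, hs⟩ := exists_bump (E := E) h
  have h0 : ∀ᶠ y in 𝓝 x, (1 - χ : SmoothFunction E M) y = 0 := by
    filter_upwards [h1] with y hy
    change 1 - χ y = 0
    rw [hy, sub_self]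
  refine Submodule.subset_span ⟨1 - χ, s, h0.self_of_nhds,
    dAt_eq_zero_of_eventually_const h0, ?_⟩
  have h2 := smulSection_bump_eq_zero hs
  ext y
  have h3 : χ y • s.1 y = 0 := congrFun (congrArg Subtype.val h2) y
  change s.1 y = (1 - χ y) • s.1 y
  rw [sub_smul, h3, one_smul, sub_zero]

theorem mem_vanishingJets_of_eventually_eq_smul {x : M} {ρ : normalSections H} {s : normalSections H}
    {f : SmoothFunction E M} (h : ∀ᶠ y in 𝓝 x, s.1 y = f y • ρ.1 y) (hf : f x = 0)
    (hdf : ∀ v, dAt f x v = 0) : s ∈ vanishingJets H x := by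
  rw [← sub_add_cancel s (smulSection f ρ)]
  refine Submodule.add_mem _ (mem_vanishingJets_of_eventually_eq_zero ?_)
    (Submodule.subset_span ⟨f, ρ, hf, hdf, rfl⟩)
  filter_upwards [h] with y hy
  rw [Submodule.coe_sub, Pi.sub_apply, hy, smulSection_apply, sub_self]

theorem IsContactStructure.exists_localGenerator (hH : IsContactStructure H) (x : M) :
    ∃ ρ : normalSections H, IsLocalGenerator H x ρ := by
  set A := hH.adaptedFrame x
  refine ⟨theta H A.R, ?_, fun s => ?_⟩
  · filter_upwards [A.eventually_mem] with y hy using A.mkQ_R_ne_zero hy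
  · obtain ⟨Y, hY⟩ := s.2 x
    refine ⟨A.trans Y, ?_⟩
    filter_upwards [hY, A.eventually_mem] with y h1 h2
    rw [h1, A.mkQ_apply Y h2]
    rfl

/-- Write `s = f ρ` near `x`: derivations with `v = 0` detect `f(x)`, those with `w = 0` detect the
differential of `f`. -/
theorem IsContactStructure.jetPairing_injective (hH : IsContactStructure H) (x : M) :
    Function.Injective (jetPairing H x) := by
  rw [injective_iff_map_eq_zero]
  intro ψ hψ
  obtain ⟨s, rfl⟩ := jet_surjective x ψ
  obtain ⟨ρ, hρ⟩ := hH.exists_localGenerator x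
  obtain ⟨f, hf⟩ := hρ.exists_coeff s
  have h0 : ∀ v w, dAt f x v • ρ.1 x + f x • w = 0 := fun v w => by
    obtain ⟨δ, hδ⟩ := hρ.exists_derivation v w
    rw [← hδ s f hf]
    exact LinearMap.congr_fun hψ δ
  refine (Submodule.Quotient.mk_eq_zero _).2 (mem_vanishingJets_of_eventually_eq_smul hf ?_ fun v => ?_)
  · have := h0 0 (ρ.1 x)
    simpa [dAt, hρ.apply_ne_zero] using this
  · have := h0 v 0
    simpa [hρ.apply_ne_zero] using this

/-- The content is that the symbol vanishes too: the Leibniz rule on `f ρ` leaves `v(f) ρ(x) = 0`,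
and functions separate tangent vectors. -/
theorem IsContactStructure.jetPairing_flip_injective (hH : IsContactStructure H) (x : M) :
    Function.Injective (jetPairing H x).flip := by
  rw [injective_iff_map_eq_zero]
  intro δ hδ
  obtain ⟨ρ, hρ⟩ := hH.exists_localGenerator x
  have h0 : ∀ s, δ.1.1 s = 0 := fun s => LinearMap.congr_fun hδ (jet x s)
  refine Subtype.ext (Prod.ext (LinearMap.ext h0) (eq_zero_of_dAt_eq_zero fun f => ?_))
  have h := δ.2 f ρ
  rw [h0, h0, smul_zero, add_zero, eq_comm, smul_eq_zero] at h
  exact h.resolve_right hρ.apply_ne_zero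

/-- A derivation at `x` is determined by its symbol and its value on a local generator. -/
theorem IsContactStructure.finiteDimensional_derivationFibre (hH : IsContactStructure H) (x : M) :
    FiniteDimensional ℝ (derivationFibre H x) := by
  obtain ⟨ρ, hρ⟩ := hH.exists_localGenerator x
  let φ : derivationFibre H x →ₗ[ℝ] TangentSpace 𝓘(ℝ, E) x × NormalFibre H x :=
    (LinearMap.prod (LinearMap.snd ℝ _ _) (LinearMap.applyₗ ρ ∘ₗ LinearMap.fst ℝ _ _)) ∘ₗ
      (derivationFibre H x).subtype
  refine FiniteDimensional.of_injective φ fun δ δ' hδ => ?_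
  have h1 : δ.1.2 = δ'.1.2 := congrArg Prod.fst hδ
  have h2 : δ.1.1 ρ = δ'.1.1 ρ := congrArg Prod.snd hδ
  refine Subtype.ext (Prod.ext (LinearMap.ext fun s => ?_) h1)
  obtain ⟨f, hf⟩ := hρ.exists_coeff s
  rw [derivationFibre_apply δ hf, derivationFibre_apply δ' hf, h1, h2]

theorem IsContactStructure.finiteDimensional_jetFibre (hH : IsContactStructure H) (x : M) :
    FiniteDimensional ℝ (JetFibre H x) :=
  have := hH.finiteDimensional_derivationFibre x
  finiteDimensional_of_lineValued_nondegenerate (V := JetFibre H x)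
    (W := derivationFibre H x) (L := NormalFibre H x) (B := jetPairing H x)
    (hH.corank_one x) (hH.jetPairing_injective x)

theorem IsContactStructure.finrank_jetFibre (hH : IsContactStructure H) (x : M) :
    Module.finrank ℝ (JetFibre H x) = Module.finrank ℝ (derivationFibre H x) :=
  have := hH.finiteDimensional_derivationFibre x
  finrank_eq_of_lineValued_nondegenerate (V := JetFibre H x)
    (W := derivationFibre H x) (L := NormalFibre H x) (B := jetPairing H x)
    (hH.corank_one x) (hH.jetPairing_injective x)
    (hH.jetPairing_flip_injective x)

theorem IsContactStructure.jetPairing_bijective (hH : IsContactStructure H) (x : M) :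
    Function.Bijective (jetPairing H x) :=
  have := hH.finiteDimensional_derivationFibre x
  bijective_of_lineValued_nondegenerate (V := JetFibre H x)
    (W := derivationFibre H x) (L := NormalFibre H x) (B := jetPairing H x)
    (hH.corank_one x) (hH.jetPairing_injective x)
    (hH.jetPairing_flip_injective x)

theorem IsContactStructure.jetPairing_flip_bijective (hH : IsContactStructure H) (x : M) :
    Function.Bijective (jetPairing H x).flip :=
  have := hH.finiteDimensional_derivationFibre x
  flip_bijective_of_lineValued_nondegenerate (V := JetFibre H x)
    (W := derivationFibre H x) (L := NormalFibre H x) (B := jetPairing H x)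
    (hH.corank_one x) (hH.jetPairing_injective x) (hH.jetPairing_flip_injective x)

end Pairing

/-! ### The Jacobi bracket, the map `sharp`, and the two inverse forms. -/

section JacobiBracket

variable {E : Type*} [NormedAddCommGroup E] [NormedSpace ℝ E]
  {M : Type*} [TopologicalSpace M] [ChartedSpace E M] [IsManifold 𝓘(ℝ, E) ∞ M]
  {H : SubspaceField E M} [FiniteDimensional ℝ E]

theorem jacobiBracket_swap (s t : normalSections H) :
    jacobiBracket H s t = -jacobiBracket H t s := by
  rw [jacobiBracket, fieldBracket_swap, map_neg]
  rfl

theorem jacobiBracket_self (s : normalSections H) : jacobiBracket H s s = 0 := by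
  rw [jacobiBracket, fieldBracket_self, map_zero]

variable (H) in
/-- Evaluation of derivations at a point, as a linear map. -/
def derivationAtₗ (x : M) : derivations H →ₗ[ℝ] derivationFibre H x where
  toFun D := derivationAt D x
  map_add' _ _ := rfl
  map_smul' _ _ := rfl

/-- The map `X ↦ D(θ X) + θ [X, σ(D)]` at `x`. -/
def symbolDefect (D : derivations H) (x : M) : SmoothField E M →ₗ[ℝ] NormalFibre H x :=
  (derivationAt D x).1.1 ∘ₗ theta H +
    LinearMap.proj x ∘ₗ (normalSections H).subtype ∘ₗ theta H ∘ₗ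
      (bracketBilin E M).flip (symbol D)

theorem symbolDefect_apply (D : derivations H) (x : M) (X : SmoothField E M) :
    symbolDefect D x X =
      (derivationApply D (theta H X)).1 x + (H x).mkQ (fieldBracket X (symbol D) x) := rfl

/-- Isolates the dependence on `D₁`: the first term uses only its value at `x`, the second only its
symbol. -/
theorem atiyahDifferential_apply (D₁ D₂ : derivations H) (x : M) :
    (atiyahDifferential (atiyahTheta H) D₁ D₂).1 x =
      (derivationAt D₁ x).1.1 (theta H (symbol D₂)) - symbolDefect D₂ x (symbol D₁) := by
  rw [symbolDefect_apply, ← sub_sub]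
  rfl

theorem atiyahDifferential_self (D : derivations H) :
    atiyahDifferential (atiyahTheta H) D D = 0 := by
  have : atiyahTheta H (derivationBracket D D) = 0 := by
    change theta H (fieldBracket (symbol D) (symbol D)) = 0
    rw [fieldBracket_self, map_zero]
  rw [atiyahDifferential, this, sub_self, sub_zero]

variable [T2Space M]

theorem IsContactStructure.hamiltonianField_spec (hH : IsContactStructure H)
    (s : normalSections H) :
    IsContactField H (hamiltonianField H s) ∧ theta H (hamiltonianField H s) = s := by
  have h := (hH.existsUnique_contactField s).exists
  rw [hamiltonianField, dif_pos h]
  exact h.choose_spec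

theorem IsContactStructure.mkQ_hamiltonianField (hH : IsContactStructure H)
    (s : normalSections H) (y : M) : (H y).mkQ (hamiltonianField H s y) = s.1 y := by
  conv_rhs => rw [← (hH.hamiltonianField_spec s).2]
  rfl

theorem IsContactStructure.hamiltonianField_eq (hH : IsContactStructure H)
    {s : normalSections H} {X : SmoothField E M} (hX : IsContactField H X) (hs : theta H X = s) :
    hamiltonianField H s = X :=
  (hH.existsUnique_contactField s).unique (hH.hamiltonianField_spec s) ⟨hX, hs⟩

theorem IsContactStructure.hamiltonianField_add (hH : IsContactStructure H)
    (s t : normalSections H) :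
    hamiltonianField H (s + t) = hamiltonianField H s + hamiltonianField H t := by
  refine hH.hamiltonianField_eq (fun W hW => ?_) ?_
  · rw [← bracketBilin_apply, map_add, LinearMap.add_apply]
    exact (tangentFields H).add_mem ((hH.hamiltonianField_spec s).1 W hW)
      ((hH.hamiltonianField_spec t).1 W hW)
  · rw [map_add, (hH.hamiltonianField_spec s).2, (hH.hamiltonianField_spec t).2]

theorem IsContactStructure.hamiltonianField_smul (hH : IsContactStructure H)
    (c : ℝ) (s : normalSections H) :
    hamiltonianField H (c • s) = c • hamiltonianField H s := by
  refine hH.hamiltonianField_eq (fun W hW => ?_) ?_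
  · rw [← bracketBilin_apply, map_smul, LinearMap.smul_apply]
    exact (tangentFields H).smul_mem c ((hH.hamiltonianField_spec s).1 W hW)
  · rw [map_smul, (hH.hamiltonianField_spec s).2]

/-- In the Jacobi bracket, the second Hamiltonian vector field may be replaced by any vector field
with the same class modulo `H`. -/
theorem IsContactStructure.jacobiBracket_apply_eq (hH : IsContactStructure H)
    (s : normalSections H) {t : normalSections H} {x : M} {Y : SmoothField E M}
    (hY : ∀ᶠ y in 𝓝 x, t.1 y = (H y).mkQ (Y y)) :
    (jacobiBracket H s t).1 x = (H x).mkQ (fieldBracket (hamiltonianField H s) Y x) := by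
  have hZ : ∀ᶠ y in 𝓝 x, (hamiltonianField H t - Y) y ∈ H y := by
    filter_upwards [hY] with y hy
    rw [mem_iff_mkQ_eq_zero, ContMDiffSection.coe_sub, Pi.sub_apply, map_sub,
      hH.mkQ_hamiltonianField, hy, sub_self]
  obtain ⟨Z, hZH, hZe⟩ := exists_tangentField_eventually_eq hZ
  have h1 := mem_iff_mkQ_eq_zero.1 ((hH.hamiltonianField_spec s).1 Z hZH x)
  rw [← fieldBracket_congr (Filter.Eventually.of_forall fun _ => rfl) hZe, ← bracketBilin_apply,
    map_sub, ContMDiffSection.coe_sub, Pi.sub_apply, map_sub, sub_eq_zero] at h1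
  exact h1

/-- The derivation `{s, -}` of `L`, with symbol `X_s`. -/
def IsContactStructure.hamiltonianDerivation (hH : IsContactStructure H) :
    normalSections H →ₗ[ℝ] derivations H where
  toFun s := ⟨⟨
    { toFun := jacobiBracket H s
      map_add' := fun t u => by
        simp only [jacobiBracket, hH.hamiltonianField_add, ← bracketBilin_apply, map_add]
      map_smul' := fun c t => by
        simp only [jacobiBracket, hH.hamiltonianField_smul, ← bracketBilin_apply, map_smul,
          RingHom.id_apply] }, hamiltonianField H s⟩, fun f t => by
    ext x
    change (jacobiBracket H s (smulSection f t)).1 x =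
      dAt f x (hamiltonianField H s x) • t.1 x + f x • (jacobiBracket H s t).1 x
    -- `f X_t` is in general not contact, but it has the class `f t` modulo `H`, which suffices in
    -- the second slot.
    rw [hH.jacobiBracket_apply_eq s (Y := smulField f (hamiltonianField H t)),
      fieldBracket_smul_right_apply, map_add, map_smul, map_smul, hH.mkQ_hamiltonianField]
    · rfl
    · refine Filter.Eventually.of_forall fun y => ?_
      rw [smulField_apply, map_smul, hH.mkQ_hamiltonianField]
      rfl⟩
  map_add' s t := by
    refine Subtype.ext (Prod.ext (LinearMap.ext fun u => ?_) (hH.hamiltonianField_add s t))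
    change jacobiBracket H (s + t) u = jacobiBracket H s u + jacobiBracket H t u
    simp only [jacobiBracket, hH.hamiltonianField_add, ← bracketBilin_apply, map_add,
      LinearMap.add_apply]
  map_smul' c s := by
    refine Subtype.ext (Prod.ext (LinearMap.ext fun u => ?_) (hH.hamiltonianField_smul c s))
    change jacobiBracket H (c • s) u = c • jacobiBracket H s u
    simp only [jacobiBracket, hH.hamiltonianField_smul, ← bracketBilin_apply, map_smul,
      LinearMap.smul_apply]

theorem IsContactStructure.symbol_hamiltonianDerivation (hH : IsContactStructure H)
    (s : normalSections H) : symbol (hH.hamiltonianDerivation s) = hamiltonianField H s := rfl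

/-- The map `J¹_x L → D_x L`, `j¹_x s ↦ {s, -}`. -/
def IsContactStructure.sharp (hH : IsContactStructure H) (x : M) :
    JetFibre H x →ₗ[ℝ] derivationFibre H x :=
  Submodule.liftQ (M₂ := derivationFibre H x) (vanishingJets H x)
      (derivationAtₗ H x ∘ₗ hH.hamiltonianDerivation) fun s hs => by
    rw [LinearMap.mem_ker]
    -- Well-definedness comes from skew-symmetry: `{s, t} = -{t, s}`, and at `x` the derivation `{t,
    -- -}` sees only the jet of `s`.
    apply hH.jetPairing_flip_injective x
    rw [map_zero]
    refine LinearMap.ext fun ψ => ?_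
    obtain ⟨t, rfl⟩ := jet_surjective x ψ
    have h1 : jetPairing H x (jet x s) (derivationAt (hH.hamiltonianDerivation t) x) = 0 := by
      rw [show jet x s = 0 from (Submodule.Quotient.mk_eq_zero _).2 hs, map_zero,
        LinearMap.zero_apply]
    change (jacobiBracket H t s).1 x = 0 at h1
    change (jacobiBracket H s t).1 x = 0
    rw [jacobiBracket_swap]
    change -(jacobiBracket H t s).1 x = 0
    rw [h1, neg_zero]

theorem IsContactStructure.sharp_jet (hH : IsContactStructure H) (x : M) (s : normalSections H) :
    hH.sharp x (jet x s) = derivationAt (hH.hamiltonianDerivation s) x := rfl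

theorem IsContactStructure.jetPairing_sharp (hH : IsContactStructure H) (x : M)
    (s t : normalSections H) :
    jetPairing H x (jet x t) (hH.sharp x (jet x s)) = (jacobiBracket H s t).1 x := rfl

theorem IsContactStructure.jetPairing_sharp_swap (hH : IsContactStructure H) (x : M)
    (ψ ψ' : JetFibre H x) :
    jetPairing H x ψ' (hH.sharp x ψ) = -jetPairing H x ψ (hH.sharp x ψ') := by
  obtain ⟨s, rfl⟩ := jet_surjective x ψ
  obtain ⟨t, rfl⟩ := jet_surjective x ψ'
  rw [hH.jetPairing_sharp, hH.jetPairing_sharp, jacobiBracket_swap]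
  rfl

/-- Write `s = f θ(R)` near `x`. From `X_s(x) = 0` follow `f(x) = 0` and the vanishing of `df` on `H
x`; from `{s, θ(R)}(x) = 0` follows its vanishing on the transverse vector `X_{θ(R)}(x)`. So the jet
of `s` is zero. -/
theorem IsContactStructure.sharp_injective (hH : IsContactStructure H) (x : M) :
    Function.Injective (hH.sharp x) := by
  rw [injective_iff_map_eq_zero]
  intro ψ hψ
  obtain ⟨s, rfl⟩ := jet_surjective x ψ
  have hXx : hamiltonianField H s x = 0 := congrArg (fun δ => δ.1.2) hψ
  have hbr : ∀ t, (jacobiBracket H s t).1 x = 0 := fun t =>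
    congrArg (fun δ : derivationFibre H x => δ.1.1 t) hψ
  set A := hH.adaptedFrame x
  obtain ⟨f, hf⟩ : ∃ f : SmoothFunction E M, ∀ᶠ y in 𝓝 x, s.1 y = f y • (theta H A.R).1 y := by
    obtain ⟨Y, hY⟩ := s.2 x
    refine ⟨A.trans Y, ?_⟩
    filter_upwards [hY, A.eventually_mem] with y h1 h2
    rw [h1, A.mkQ_apply Y h2]
    rfl
  have hR : (H x).mkQ (A.R x) ≠ 0 := A.mkQ_R_ne_zero A.mem
  have hfx : f x = 0 := by
    have h := hf.self_of_nhds
    rw [← hH.mkQ_hamiltonianField, hXx, map_zero, eq_comm, smul_eq_zero] at h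
    exact h.resolve_right hR
  -- along `H`, the differential of `f` is the curvature with the `H`-component of `X_s`
  have hdH : ∀ v ∈ H x, dAt f x v = 0 := by
    intro v hv
    obtain ⟨W, hW, rfl⟩ := hH.smooth x v hv
    have hZ : ∀ᶠ y in 𝓝 x, (hamiltonianField H s - smulField f A.R) y ∈ H y := by
      filter_upwards [hf] with y hy
      rw [mem_iff_mkQ_eq_zero, ContMDiffSection.coe_sub, Pi.sub_apply, map_sub,
        hH.mkQ_hamiltonianField, hy, smulField_apply, map_smul, theta_apply, sub_self]
    -- `X_s - f R` is tangent to `H` near `x` and vanishes at `x`, so its bracket with `W` lies in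
    -- `H x`; so does that of `X_s`, which leaves `df(W) R`.
    have h1 := hH.mkQ_bracket_eq_zero hZ (by simp [hXx, hfx]) W
    have h2 := mem_iff_mkQ_eq_zero.1 ((hH.hamiltonianField_spec s).1 W hW x)
    rw [← bracketBilin_apply, map_sub, ContMDiffSection.coe_sub, Pi.sub_apply, map_sub,
      bracketBilin_apply, bracketBilin_apply, mkQ_bracket_swap W, h2,
      fieldBracket_smul_right_apply, hfx, zero_smul, add_zero, neg_zero, zero_sub, neg_eq_zero,
      map_smul, smul_eq_zero] at h1
    exact h1.resolve_right hR
  have hdR : dAt f x (hamiltonianField H (theta H A.R) x) = 0 := by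
    have h1 := derivationFibre_apply
      (derivationAt (hH.hamiltonianDerivation (theta H A.R)) x) hf
    change (jacobiBracket H (theta H A.R) s).1 x =
      dAt f x (hamiltonianField H (theta H A.R) x) • (H x).mkQ (A.R x) + _ at h1
    rw [jacobiBracket_swap, hfx, zero_smul, add_zero] at h1
    change -(jacobiBracket H s (theta H A.R)).1 x = _ at h1
    rw [hbr, neg_zero, eq_comm, smul_eq_zero] at h1
    exact h1.resolve_right hR
  refine (Submodule.Quotient.mk_eq_zero _).2
    (mem_vanishingJets_of_eventually_eq_smul hf hfx fun v => ?_)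
  obtain ⟨Y, rfl⟩ := exists_field_apply_eq v
  set c := A.trans Y x
  have hmem : Y x - c • hamiltonianField H (theta H A.R) x ∈ H x := by
    rw [mem_iff_mkQ_eq_zero, map_sub, map_smul, hH.mkQ_hamiltonianField, A.mkQ_apply Y A.mem,
      theta_apply, sub_self]
  have h3 := hdH _ hmem
  rw [dAt, map_sub, map_smul] at h3
  change dAt f x (Y x) - c • dAt f x (hamiltonianField H (theta H A.R) x) = 0 at h3
  rwa [hdR, smul_zero, sub_zero] at h3

theorem IsContactStructure.sharp_bijective (hH : IsContactStructure H) (x : M) :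
    Function.Bijective (hH.sharp x) := by
  have := hH.finiteDimensional_derivationFibre x
  have := hH.finiteDimensional_jetFibre x
  exact ⟨hH.sharp_injective x,
    (LinearMap.injective_iff_surjective_of_finrank_eq_finrank
      (V := JetFibre H x) (V₂ := derivationFibre H x) (f := hH.sharp x) (hH.finrank_jetFibre x)).1
      (hH.sharp_injective x)⟩

/-- Every element of `D_x L` thus extends to a global derivation, which makes the Atiyah form unique
and lets it be computed on the derivations `{s, -}`. -/
theorem IsContactStructure.exists_hamiltonianDerivation (hH : IsContactStructure H) {x : M}
    (δ : derivationFibre H x) :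
    ∃ s, derivationAt (hH.hamiltonianDerivation s) x = δ := by
  obtain ⟨ψ, rfl⟩ := (hH.sharp_bijective x).2 δ
  obtain ⟨s, rfl⟩ := jet_surjective x ψ
  exact ⟨s, rfl⟩

/-- The isomorphism `D_x L ≅ J¹_x L` inverse to `j¹_x s ↦ -{s, -}`. -/
def IsContactStructure.flat (hH : IsContactStructure H) (x : M) :
    derivationFibre H x ≃ₗ[ℝ] JetFibre H x :=
  (LinearEquiv.ofBijective (hH.sharp x) (hH.sharp_bijective x)).symm ≪≫ₗ LinearEquiv.neg ℝ

theorem IsContactStructure.flat_sharp (hH : IsContactStructure H) (x : M) (ψ : JetFibre H x) :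
    hH.flat x (hH.sharp x ψ) = -ψ := by
  change -((LinearEquiv.ofBijective (hH.sharp x) (hH.sharp_bijective x)).symm (hH.sharp x ψ)) = -ψ
  rw [LinearEquiv.ofBijective_symm_apply_apply]

theorem IsContactStructure.flat_symm_apply (hH : IsContactStructure H) (x : M)
    (ψ : JetFibre H x) : (hH.flat x).symm ψ = hH.sharp x (-ψ) := rfl

/-- Replacing `X` by `f X`, the Leibniz term `σ(D)(f) θ(X)` of `D` cancels the one of the bracket,
so the defect is tensorial in `X`. -/
theorem symbolDefect_eq_zero (D : derivations H) {x : M} {X : SmoothField E M} (hX : X x = 0) :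
    symbolDefect D x X = 0 := by
  refine map_eq_zero_of_apply_eq_zero (fun f Y => ?_) hX
  have h := (derivationAt D x).2 f (theta H Y)
  change (derivationApply D (smulSection f (theta H Y))).1 x =
    dAt f x (symbol D x) • (H x).mkQ (Y x) + f x • (derivationApply D (theta H Y)).1 x at h
  rw [symbolDefect_apply, symbolDefect_apply, theta_smulField, h, fieldBracket_smul_left_apply,
    map_add, map_smul, map_smul]
  module

/-- `d_D Θ (D₁, D₂)` at `x` only depends on the value of `D₁` at `x`. -/
theorem atiyahDifferential_congr_left {D₁ D₁' : derivations H} (D₂ : derivations H) {x : M}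
    (h : derivationAt D₁ x = derivationAt D₁' x) :
    (atiyahDifferential (atiyahTheta H) D₁ D₂).1 x =
      (atiyahDifferential (atiyahTheta H) D₁' D₂).1 x := by
  have h1 : (symbol D₁ - symbol D₁') x = 0 := by
    rw [ContMDiffSection.coe_sub, Pi.sub_apply]
    exact sub_eq_zero.2 (congrArg (fun δ : derivationFibre H x => δ.1.2) h)
  have h2 := symbolDefect_eq_zero D₂ h1
  rw [map_sub, sub_eq_zero] at h2
  rw [atiyahDifferential_apply, atiyahDifferential_apply, h, h2]

/-- With `Y = σ(D)`, the terms `{s, θ Y}` and `θ[X_s, Y]` cancel, and `θ(X_s) = s` in the remaining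
one. -/
theorem IsContactStructure.atiyahDifferential_hamiltonianDerivation (hH : IsContactStructure H)
    (s : normalSections H) (D : derivations H) (x : M) :
    (atiyahDifferential (atiyahTheta H) (hH.hamiltonianDerivation s) D).1 x =
      -(derivationApply D s).1 x := by
  rw [atiyahDifferential_apply, symbolDefect_apply, hH.symbol_hamiltonianDerivation,
    (hH.hamiltonianField_spec s).2]
  have h1 : (derivationAt (hH.hamiltonianDerivation s) x).1.1 (theta H (symbol D)) =
      (H x).mkQ (fieldBracket (hamiltonianField H s) (symbol D) x) :=
    hH.jacobiBracket_apply_eq s (Filter.Eventually.of_forall fun _ => rfl)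
  rw [h1]
  abel

/-- Replace `D₁` by some `{s, -}` with the same value at `x`; both sides are then `-D₂(s)` at `x`,
which explains the sign in `flat`. -/
theorem IsContactStructure.jetPairing_flat (hH : IsContactStructure H) (x : M)
    (D₁ D₂ : derivations H) :
    jetPairing H x (hH.flat x (derivationAt D₁ x)) (derivationAt D₂ x) =
      (atiyahDifferential (atiyahTheta H) D₁ D₂).1 x := by
  obtain ⟨s, hs⟩ := hH.exists_hamiltonianDerivation (derivationAt D₁ x)
  rw [← atiyahDifferential_congr_left D₂ hs, hH.atiyahDifferential_hamiltonianDerivation, ← hs,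
    ← hH.sharp_jet, hH.flat_sharp, LinearMap.map_neg, LinearMap.neg_apply]
  rfl

/-- The symplectic Atiyah form of a contact structure. -/
def IsContactStructure.atiyahForm (hH : IsContactStructure H) : AtiyahTwoForm H where
  toFun x := jetPairing H x ∘ₗ (hH.flat x).toLinearMap
  alternating x δ := by
    obtain ⟨s, rfl⟩ := hH.exists_hamiltonianDerivation δ
    refine (hH.jetPairing_flat x _ _).trans ?_
    rw [atiyahDifferential_self]
    rfl
  smooth D₁ D₂ := by
    convert (atiyahDifferential (atiyahTheta H) D₁ D₂).2 using 1
    exact funext fun x => hH.jetPairing_flat x D₁ D₂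

/-- The Jacobi tensor of a contact structure. -/
def IsContactStructure.jacobiTensor (hH : IsContactStructure H) : JetTwoForm H where
  toFun x := (jetPairing H x).flip ∘ₗ hH.sharp x
  alternating x ψ := by
    obtain ⟨s, rfl⟩ := jet_surjective x ψ
    change (jacobiBracket H s s).1 x = 0
    rw [jacobiBracket_self]
    rfl
  smooth s t := (jacobiBracket H s t).2

theorem IsContactStructure.isAssociatedAtiyahForm_atiyahForm (hH : IsContactStructure H) :
    IsAssociatedAtiyahForm H hH.atiyahForm :=
  fun D₁ D₂ x => hH.jetPairing_flat x D₁ D₂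

theorem IsContactStructure.isJacobiTensor_jacobiTensor (hH : IsContactStructure H) :
    IsJacobiTensor H hH.jacobiTensor :=
  fun _ _ _ => rfl

theorem IsContactStructure.eq_atiyahForm (hH : IsContactStructure H) {Ω : AtiyahTwoForm H}
    (hΩ : IsAssociatedAtiyahForm H Ω) : Ω = hH.atiyahForm := by
  have h : Ω.toFun = hH.atiyahForm.toFun := by
    refine funext fun x => LinearMap.ext fun δ => LinearMap.ext fun δ' => ?_
    obtain ⟨s, rfl⟩ := hH.exists_hamiltonianDerivation δ
    obtain ⟨t, rfl⟩ := hH.exists_hamiltonianDerivation δ'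
    rw [hΩ, hH.isAssociatedAtiyahForm_atiyahForm]
  cases Ω
  cases h
  rfl

theorem IsContactStructure.eq_jacobiTensor (hH : IsContactStructure H) {J : JetTwoForm H}
    (hJ : IsJacobiTensor H J) : J = hH.jacobiTensor := by
  have h : J.toFun = hH.jacobiTensor.toFun := by
    refine funext fun x => LinearMap.ext fun ψ => LinearMap.ext fun ψ' => ?_
    obtain ⟨s, rfl⟩ := jet_surjective x ψ
    obtain ⟨t, rfl⟩ := jet_surjective x ψ'
    rw [hJ, hH.isJacobiTensor_jacobiTensor]
  cases J
  cases h
  rfl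

/-- The sign in `flat` is absorbed by the skew-symmetry of the Jacobi bracket, since `J` has `ψ` in
its second slot. -/
theorem IsContactStructure.isInverse (hH : IsContactStructure H) :
    IsInverse H hH.atiyahForm hH.jacobiTensor := by
  refine fun x => ⟨hH.flat x, fun δ δ' => rfl, fun ψ ψ' => ?_⟩
  rw [hH.flat_symm_apply, hH.jetPairing_sharp_swap, map_neg, LinearMap.neg_apply, neg_neg]
  rfl

end JacobiBracket

end ContactGeometry

end

theorem proposition4p2
    {E : Type*} [NormedAddCommGroup E] [NormedSpace ℝ E] [FiniteDimensional ℝ E]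
    {M : Type*} [TopologicalSpace M] [T2Space M] [SigmaCompactSpace M]
    [ChartedSpace E M] [IsManifold 𝓘(ℝ, E) ∞ M]
    (H : ContactGeometry.SubspaceField E M) (hH : ContactGeometry.IsContactStructure H) :
    -- every section of `L` has a unique Hamiltonian vector field
    (∀ s : ContactGeometry.normalSections H, ∃! X : ContactGeometry.SmoothField E M,
      ContactGeometry.IsContactField H X ∧ ContactGeometry.theta H X = s) ∧
    -- the identifications `J¹L ≅ Hom(DL, L)` and `DL ≅ Hom(J¹L, L)`
    (∀ x : M, Function.Bijective (ContactGeometry.jetPairing H x)) ∧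
    (∀ x : M, Function.Bijective (ContactGeometry.jetPairing H x).flip) ∧
    -- the Atiyah form and the Jacobi tensor exist, are unique, and are inverse to each other
    (∃! Ω : ContactGeometry.AtiyahTwoForm H, ContactGeometry.IsAssociatedAtiyahForm H Ω) ∧
    (∃! J : ContactGeometry.JetTwoForm H, ContactGeometry.IsJacobiTensor H J) ∧
    (∀ (Ω : ContactGeometry.AtiyahTwoForm H) (J : ContactGeometry.JetTwoForm H),
      ContactGeometry.IsAssociatedAtiyahForm H Ω → ContactGeometry.IsJacobiTensor H J →
      ContactGeometry.IsInverse H Ω J) :=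
  ⟨hH.existsUnique_contactField, hH.jetPairing_bijective, hH.jetPairing_flip_bijective,
    ⟨hH.atiyahForm, hH.isAssociatedAtiyahForm_atiyahForm, fun _ hΩ => hH.eq_atiyahForm hΩ⟩,
    ⟨hH.jacobiTensor, hH.isJacobiTensor_jacobiTensor, fun _ hJ => hH.eq_jacobiTensor hJ⟩,
    fun _ _ hΩ hJ => hH.eq_atiyahForm hΩ ▸ hH.eq_jacobiTensor hJ ▸ hH.isInverse⟩
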